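/- **Setting.** Fix $\tau,k\in\mathbb C$ and write $q^a=e^{a\tau}$, $q=e^\tau$, $[x]=\frac{q^x-q^{-x}}{q-q^{-1}}$; assume $|q|<1$ and $|q^k|<1$ (i.e. $\operatorname{Re}\tau<0$, $\operatorname{Re}(k\tau)<0$; for $0<q<1$ and real $k$ this says $k>0$). Let $\alpha_n,\bar\alpha_n,\beta_n$ ($n\in\mathbb Z$) generate three commuting Heisenberg algebras with, for $m\ge1$, $$[\alpha_m,\alpha_{-m}]=\tfrac{[2m][km]}{m},\qquad [\bar\alpha_m,\bar\alpha_{-m}]=-\tfrac{[2m][km]}{m},\qquad [\beta_m,\beta_{-m}]=\tfrac{[2m][(k+2)m]}{m}.$$ They act on the Fock modules $F_{l,m_1,m_2}$ ($l,m_1,m_2\in\mathbb C$), on which $\beta_0,\alpha_0,\bar\alpha_0$ are the scalars $2l,\,2m_1,\,-2m_2$, and $e^{2r\beta+2s_1\alpha+2s_2\bar\alpha}$ maps $F_{l,m_1,m_2}$ to $F_{l+r,m_1+s_1,m_2+s_2}$, commuting with all nonzero modes. Normal ordering $:\ :$ puts creation operators and shifts $e^{(\cdots)}$ to the left of zero modes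 and annihilation operators. Put $$\bar Y^{\pm}(z)=\exp\Big\{\pm\sum_{m\ge1}\tfrac{q^{\mp km/2}z^m}{[km]}\bar\alpha_{-m}\Big\}e^{\pm2\bar\alpha}z^{\pm\bar\alpha_0/k}\exp\Big\{\mp\sum_{m\ge1}\tfrac{q^{\mp km/2}z^{-m}}{[km]}\bar\alpha_m\Big\},$$ $$Z_{\pm}(z)=\exp\Big\{\mp(q-q^{-1})\sum_{m\ge1}z^{\mp m}\tfrac{[m]}{[2m]}\bar\alpha_{\pm m}\Big\}q^{\mp\bar\alpha_0/2},\qquad W_\pm(z)=\exp\Big\{\mp(q-q^{-1})\sum_{m\ge1}z^{\mp m}\tfrac{[m]}{[2m]}\beta_{\pm m}\Big\}q^{\mp\beta_0/2},$$ $$\Phi^{+}(z)=\tfrac1{q-q^{-1}}:\bar Y^+(z)\{Z_+(q^{-\frac{k+2}2}z)W_+(q^{-\frac k2}z)-W_-(q^{\frac k2}z)Z_-(q^{\frac{k+2}2}z)\}:,$$ $$\Phi^{-}(z)=\tfrac1{q-q^{-1}}:\bar Y^-(z)\{Z_+(q^{\frac{k+2}2}z)W_+(q^{\frac k2}z)^{-1}-W_-(q^{-\frac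 k2}z)^{-1}Z_-(q^{-\frac{k+2}2}z)\}:.$$ Points $z\neq0$ are given with a logarithm, which fixes all complex powers of $z$; $q^az$ has the logarithm $\log z+a\tau$. **Claim 1.** Fix $z$. Every matrix element of $\Phi^-(w)\Phi^+(z)$ converges (absolutely, as the sum over intermediate monomial states) for $|w|$ large and continues to a meromorphic function of $\log w\in\mathbb C$. Let $w_0=q^{k+2}z$, and let $L(z)=\oint\Phi^-(w)\Phi^+(z)\,dw$ be the integral of these continuations over small positively oriented circles around $w=w_0$ (with the branch of $\log w$ equal to $\log z+(k+2)\tau$ at $w_0$). Then $$L(z)=\lambda_1(z)+\lambda_2(z)+\lambda_3(z),$$ where, with $$\rho(z)=2\pi i\,w_0^{1+2/k}\,(1-q^{-4})\prod_{j\ge1}\frac{1-q^{2kj-4}}{1-q^{2kj}},$$ the $\lambda_i(z)$ are scalar multiples of vertex operators: $$\lambda_1(z)=\tfrac{\rho(z)}{(q-q^{-1})^2}\,\tfrac{q(1-q^{-2k-4})}{1-q^{-2k-2}}:\bar Y^-(q^{k+2}z)Z_+(q^{\frac{3k+6}2}z)W_+(q^{\frac{3k+4}2}z)^{-1}\bar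 Y^+(z)Z_+(q^{-\frac{k+2}2}z)W_+(q^{-\frac k2}z):,$$ $$\lambda_2(z)=-\tfrac{\rho(z)}{(q-q^{-1})^2}\,q^{-1}:\bar Y^-(q^{k+2}z)W_-(q^{\frac{k+4}2}z)^{-1}Z_-(q^{\frac{k+2}2}z)\bar Y^+(z)Z_+(q^{-\frac{k+2}2}z)W_+(q^{-\frac k2}z):,$$ $$\lambda_3(z)=-\tfrac{\rho(z)}{(q-q^{-1})^2}\,q:\bar Y^-(q^{k+2}z)Z_+(q^{\frac{3k+6}2}z)W_+(q^{\frac{3k+4}2}z)^{-1}\bar Y^+(z)W_-(q^{\frac k2}z)Z_-(q^{\frac{k+2}2}z):.$$ **Claim 2.** Assume moreover the genericity condition $q^{2kj}\ne q^4$ for all $j\ge1$ (for $0<q<1$, $k>0$: $k\notin\{2/j\}$). Then $\lambda_1(z),\lambda_2(z),\lambda_3(z)$ are linearly independent (in particular nonzero), so $L(z)$ is a sum of exactly three vertex operators. Let $V_1,V_2,V_3,V_4$ be the four products obtained by expanding $\Phi^-(w)\Phi^+(z)$, up to the scalars $\pm(q-q^{-1})^{-2}$: (first term of $\Phi^-$)(first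 of $\Phi^+$), (second)(first), (first)(second), (second)(second). For $|w|$ large, $V_i(w,z)=C_i(w,z):V_i(w,z):$ with a correlation function $C_i$ that is meromorphic in $\log w$; at $w=q^{k+2}z$, $C_1,C_2,C_3$ have a pole of order exactly one, and $C_4$ has neither a pole nor a zero. -/

import Mathlib

open Filter Topology

noncomputable section

/-- `q ^ a`, where `q = exp τ` and the complex number `τ` is the chosen value of `log q`. -/
def qPow (τ a : ℂ) : ℂ := Complex.exp (a * τ)

/-- The `q`-number `[x] = (q ^ x - q ^ (-x)) / (q - q ^ (-1))`. -/
def qNum (τ x : ℂ) : ℂ := (qPow τ x - qPow τ (-x)) / (qPow τ 1 - qPow τ (-1))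

/-! ### The three Heisenberg algebras and the Fock modules -/

/-- Labels of the three families of bosons `α_n`, `ᾱ_n`, `β_n`. -/
inductive Boson
  | alpha
  | alphaBar
  | beta

/-- Labels `(i, m)` of the creation operators `i_{-m}`, `m ≥ 1`. -/
abbrev Mode := Boson × ℕ+

/-- The values of the commutators `[i_m, i_{-m}]`, `m ≥ 1`, at level `k`. -/
def heisenberg (τ k : ℂ) : Boson → ℕ+ → ℂ
  | .alpha, m => qNum τ (2 * m) * qNum τ (k * m) / m
  | .alphaBar, m => -(qNum τ (2 * m) * qNum τ (k * m) / m)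
  | .beta, m => qNum τ (2 * m) * qNum τ ((k + 2) * m) / m

/-- A Fock label `(l, m₁, m₂)`: `c beta = l`, `c alpha = m₁`, `c alphaBar = m₂`. -/
abbrev Charge := Boson → ℂ

/-- The eigenvalue of the zero mode `i_0` on the Fock module with label `c`. -/
def zeroEigenvalue (c : Charge) : Boson → ℂ
  | .alpha => 2 * c .alpha
  | .alphaBar => -(2 * c .alphaBar)
  | .beta => 2 * c .beta

/-- The free module of rank one over the polynomial algebra in the creation operators. -/
abbrev Fock := MvPolynomial Mode ℂ

/-- The completion of a Fock module with respect to its grading. -/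
abbrev FockHat := MvPowerSeries Mode ℂ

/-- The creation operator `i_{-m}`. -/
def creation (i : Boson) (m : ℕ+) : Fock →ₗ[ℂ] Fock :=
  LinearMap.mulLeft ℂ (MvPolynomial.X (i, m))

/-- The annihilation operator `i_m`. -/
def annihilation (τ k : ℂ) (i : Boson) (m : ℕ+) : Fock →ₗ[ℂ] Fock :=
  heisenberg τ k i m • (MvPolynomial.pderiv (i, m)).toLinearMap

open Classical in
/-- The Heisenberg relations. -/
theorem annihilation_creation (τ k : ℂ) (i j : Boson) (m n : ℕ+) (p : Fock) :
    annihilation τ k i m (creation j n p) - creation j n (annihilation τ k i m p) =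
      (if (i, m) = (j, n) then heisenberg τ k i m else 0) • p := by
  simp only [annihilation, creation, LinearMap.smul_apply, LinearMap.mulLeft_apply,
    Derivation.coeFn_coe, Derivation.leibniz,
    MvPolynomial.pderiv_X, smul_eq_mul, Pi.single_apply, mul_smul_comm, smul_add]
  by_cases h : (i, m) = (j, n)
  · simp [h]
  · have h2 : ¬ (j, n) = (i, m) := fun e => h e.symm
    simp [h, h2]

/-- The direct sum of all Fock modules `F_{l, m₁, m₂}`. -/
abbrev FockSum := Charge →₀ Fock

/-- The product of all completed Fock modules. -/
abbrev FockSumHat := Charge → FockHat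

/-- Operators from the Fock modules to their completions. -/
abbrev FockOp := FockSum →ₗ[ℂ] FockSumHat

/-! ### Normally ordered exponentials -/

/-- A linear form `φ` in the modes `i_n` (`n ∈ ℤ`, coefficients `φ.1 i n`) and in the symbols
`α`, `ᾱ`, `β` conjugate to the zero modes (coefficients `φ.2 i`). -/
abbrev LinForm := (Boson → ℤ → ℂ) × (Boson → ℂ)

/-- The operator `∑ φ_{i,m} i_m` over all `i` and all `m ≥ 1`: the derivation with
`i_{-m} ↦ φ_{i,m} [i_m, i_{-m}]`. -/
def annihilationPart (τ k : ℂ) (φ : LinForm) : Derivation ℂ Fock Fock :=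
  MvPolynomial.mkDerivation ℂ
    fun s => MvPolynomial.C (φ.1 s.1 ((s.2 : ℕ) : ℤ) * heisenberg τ k s.1 s.2)

/-- The operator `exp (∑ φ_{i,m} i_m)` over all `i` and all `m ≥ 1`; the exponential of a
derivation with constant coefficients is a translation, see `expAnnihilation_eq`. -/
def expAnnihilation (τ k : ℂ) (φ : LinForm) : Fock →ₐ[ℂ] Fock :=
  MvPolynomial.aeval fun s => MvPolynomial.X s +
    MvPolynomial.C (φ.1 s.1 ((s.2 : ℕ) : ℤ) * heisenberg τ k s.1 s.2)

/-- The power series `exp (∑ φ_{i,-m} i_{-m}) = ∏ exp (φ_{i,-m} i_{-m})` over all `i` and all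
`m ≥ 1`. -/
def expCreation (φ : LinForm) : FockHat :=
  fun s => s.prod fun i n => φ.1 i.1 (-((i.2 : ℕ) : ℤ)) ^ n / (n.factorial : ℂ)

open Classical in
/-- The normally ordered exponential `:exp φ:`
`= exp (∑ φ_{i,-m} i_{-m}) e^{φ_α α + φ_ᾱ ᾱ + φ_β β} exp (∑ φ_{i,0} i_0) exp (∑ φ_{i,m} i_m)`.
The symbol `e^{2 r β + 2 s₁ α + 2 s₂ ᾱ}` shifts `(l, m₁, m₂)` by `(r, s₁, s₂)`. The normally
ordered product of `:exp φ:` and `:exp ψ:` is `:exp (φ + ψ):`. -/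
def vertexOp (τ k : ℂ) (φ : LinForm) : FockOp :=
  Finsupp.lsum ℂ fun c : Charge =>
    Complex.exp (φ.1 .alpha 0 * zeroEigenvalue c .alpha
      + φ.1 .alphaBar 0 * zeroEigenvalue c .alphaBar + φ.1 .beta 0 * zeroEigenvalue c .beta) •
    (LinearMap.single ℂ (fun _ : Charge => FockHat) (c + (1 / 2 : ℂ) • φ.2) ∘ₗ
      LinearMap.mulLeft ℂ (expCreation φ) ∘ₗ
      (MvPolynomial.coeToMvPowerSeries.algHom ℂ (σ := Mode) (R := ℂ)).toLinearMap ∘ₗ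
      (expAnnihilation τ k φ).toLinearMap)

/-! ### Products of operators, analytic continuation, correlation functions, contour integrals

A point `z ≠ 0` is given through a logarithm `u`, `z = exp u`; then `z ^ a = exp (a u)` and
`q ^ a z` has the logarithm `u + a τ`. -/

/-- The matrix element of an operator between the vector `v` and the dual of the monomial `t` in
the Fock module with label `d`. -/
def matrixElement (A : FockOp) (v : FockSum) (d : Charge) (t : Mode →₀ ℕ) : ℂ :=
  MvPowerSeries.coeff t (A v d)

/-- The contribution of the intermediate basis vector `s` to the matrix element of `A B`. -/
def productTerm (A B : FockOp) (v : FockSum) (d : Charge) (t : Mode →₀ ℕ)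
    (s : Charge × (Mode →₀ ℕ)) : ℂ :=
  matrixElement A (Finsupp.single s.1 (MvPolynomial.monomial s.2 1)) d t *
    matrixElement B v s.1 s.2

/-- `C` is the correlation function of the vertex operators `:exp φ(w):` and `:exp ψ:`, a
meromorphic function of the local coordinate `ζ = log w`: for `|w|` large, the product of the
two operators converges and equals `C · :exp (φ(w) + ψ):`. -/
def IsCorrelationFunction (τ k : ℂ) (φ : ℂ → LinForm) (ψ : LinForm) (C : ℂ → ℂ) : Prop :=
  Meromorphic C ∧ ∃ R : ℝ, ∀ ζ : ℂ, R < ζ.re → ∀ (v : FockSum) (d : Charge) (t : Mode →₀ ℕ),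
    HasSum (productTerm (vertexOp τ k (φ ζ)) (vertexOp τ k ψ) v d t)
      (C ζ * matrixElement (vertexOp τ k (φ ζ + ψ)) v d t)

/-- `M`, a meromorphic function of `ζ = log w`, is the analytic continuation of a matrix element
of the product `A(w) B`, which converges for `|w|` large. (It is unique up to its values on a
discrete set.) -/
def IsContinuation (A : ℂ → FockOp) (B : FockOp) (v : FockSum) (d : Charge) (t : Mode →₀ ℕ)
    (M : ℂ → ℂ) : Prop :=
  Meromorphic M ∧ ∃ R : ℝ, ∀ ζ : ℂ, R < ζ.re → HasSum (productTerm (A ζ) B v d t) (M ζ)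

/-- The operator `L` is the contour integral `∮ A(w) B dw` over small circles around
`w₀ = exp ζ₀`, taken for the analytic continuation of every matrix element, with the branch of
`log w` that is `ζ₀` at `w₀`. -/
def IsContourIntegral (A : ℂ → FockOp) (B : FockOp) (ζ₀ : ℂ) (L : FockOp) : Prop :=
  ∀ (v : FockSum) (d : Charge) (t : Mode →₀ ℕ), ∃ M : ℂ → ℂ, IsContinuation A B v d t M ∧
    ∀ᶠ r : ℝ in 𝓝[>] 0,
      (∮ w in C(Complex.exp ζ₀, r), M (ζ₀ + Complex.log (w / Complex.exp ζ₀))) =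
        matrixElement L v d t

/-! ### The currents -/

/-- The linear form in the modes of the boson `i` alone, with coefficients `f n` (`n ∈ ℤ`) and
coefficient `x` of the symbol conjugate to `i_0`. -/
def LinForm.ofBoson : Boson → (ℤ → ℂ) → ℂ → LinForm
  | .alpha, f, x => (fun | .alpha => f | .alphaBar => 0 | .beta => 0,
      fun | .alpha => x | .alphaBar => 0 | .beta => 0)
  | .alphaBar, f, x => (fun | .alpha => 0 | .alphaBar => f | .beta => 0,
      fun | .alpha => 0 | .alphaBar => x | .beta => 0)
  | .beta, f, x => (fun | .alpha => 0 | .alphaBar => 0 | .beta => f,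
      fun | .alpha => 0 | .alphaBar => 0 | .beta => x)

/-- `Ȳ⁺(z) = :exp (yPlus u):`, `z = exp u`. -/
def yPlus (τ k u : ℂ) : LinForm :=
  LinForm.ofBoson .alphaBar
    (fun n =>
      if n = 0 then u / k
      else if n < 0 then qPow τ (-(k * (-n) / 2)) * Complex.exp ((-n) * u) / qNum τ (k * (-n))
      else -(qPow τ (-(k * n / 2)) * Complex.exp (-(n * u)) / qNum τ (k * n)))
    2

/-- `Ȳ⁻(z) = :exp (yMinus u):`, `z = exp u`. -/
def yMinus (τ k u : ℂ) : LinForm :=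
  LinForm.ofBoson .alphaBar
    (fun n =>
      if n = 0 then -(u / k)
      else if n < 0 then -(qPow τ (k * (-n) / 2) * Complex.exp ((-n) * u) / qNum τ (k * (-n)))
      else qPow τ (k * n / 2) * Complex.exp (-(n * u)) / qNum τ (k * n))
    (-2)

/-- The modes of `Z₊` and `W₊` in terms of their boson:
`-(q - q⁻¹) ∑_{m ≥ 1} z^{-m} ([m] / [2m]) i_m - (log q / 2) i_0`. -/
def plusModes (τ u : ℂ) (n : ℤ) : ℂ :=
  if n = 0 then -(τ / 2)
  else if n < 0 then 0
  else -((qPow τ 1 - qPow τ (-1)) * Complex.exp (-(n * u)) * (qNum τ n / qNum τ (2 * n)))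

/-- The modes of `Z₋` and `W₋` in terms of their boson:
`(q - q⁻¹) ∑_{m ≥ 1} z^m ([m] / [2m]) i_{-m} + (log q / 2) i_0`. -/
def minusModes (τ u : ℂ) (n : ℤ) : ℂ :=
  if n = 0 then τ / 2
  else if n < 0 then
    (qPow τ 1 - qPow τ (-1)) * Complex.exp ((-n) * u) * (qNum τ (-n) / qNum τ (2 * (-n)))
  else 0

/-- `Z₊(z) = :exp (zPlus u):`, `z = exp u`. -/
def zPlus (τ u : ℂ) : LinForm := LinForm.ofBoson .alphaBar (plusModes τ u) 0

/-- `Z₋(z) = :exp (zMinus u):`, `z = exp u`. -/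
def zMinus (τ u : ℂ) : LinForm := LinForm.ofBoson .alphaBar (minusModes τ u) 0

/-- `W₊(z) = :exp (wPlus u):`, `z = exp u`. -/
def wPlus (τ u : ℂ) : LinForm := LinForm.ofBoson .beta (plusModes τ u) 0

/-- `W₋(z) = :exp (wMinus u):`, `z = exp u`. -/
def wMinus (τ u : ℂ) : LinForm := LinForm.ofBoson .beta (minusModes τ u) 0

/-- The first term `:Ȳ⁺(z) Z₊(q^{-(k+2)/2} z) W₊(q^{-k/2} z):` of `Φ⁺(z)`. -/
def phiPlus₁ (τ k u : ℂ) : LinForm :=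
  yPlus τ k u + zPlus τ (u - (k + 2) / 2 * τ) + wPlus τ (u - k / 2 * τ)

/-- The second term `:Ȳ⁺(z) W₋(q^{k/2} z) Z₋(q^{(k+2)/2} z):` of `Φ⁺(z)`. -/
def phiPlus₂ (τ k u : ℂ) : LinForm :=
  yPlus τ k u + wMinus τ (u + k / 2 * τ) + zMinus τ (u + (k + 2) / 2 * τ)

/-- The first term `:Ȳ⁻(w) Z₊(q^{(k+2)/2} w) W₊(q^{k/2} w)⁻¹:` of `Φ⁻(w)`. -/
def phiMinus₁ (τ k u : ℂ) : LinForm :=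
  yMinus τ k u + zPlus τ (u + (k + 2) / 2 * τ) - wPlus τ (u + k / 2 * τ)

/-- The second term `:Ȳ⁻(w) W₋(q^{-k/2} w)⁻¹ Z₋(q^{-(k+2)/2} w):` of `Φ⁻(w)`. -/
def phiMinus₂ (τ k u : ℂ) : LinForm :=
  yMinus τ k u - wMinus τ (u - k / 2 * τ) + zMinus τ (u - (k + 2) / 2 * τ)

/-- The parafermion current `Φ⁺(z)`, `z = exp u`. -/
def PhiPlus (τ k u : ℂ) : FockOp :=
  (1 / (qPow τ 1 - qPow τ (-1))) •
    (vertexOp τ k (phiPlus₁ τ k u) - vertexOp τ k (phiPlus₂ τ k u))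

/-- The parafermion current `Φ⁻(w)`, `w = exp u`. -/
def PhiMinus (τ k u : ℂ) : FockOp :=
  (1 / (qPow τ 1 - qPow τ (-1))) •
    (vertexOp τ k (phiMinus₁ τ k u) - vertexOp τ k (phiMinus₂ τ k u))

/-! ### The three vertex operators -/

/-- `ρ(z) = 2πi w₀^{1+2/k} (1 - q^{-4}) ∏_{j ≥ 1} (1 - q^{2kj-4}) / (1 - q^{2kj})` with
`w₀ = q^{k+2} z`, `z = exp u`. -/
def rho (τ k u : ℂ) : ℂ :=
  2 * Real.pi * Complex.I * Complex.exp ((1 + 2 / k) * (u + (k + 2) * τ)) * (1 - qPow τ (-4)) *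
    ∏' j : ℕ, (1 - qPow τ (2 * k * (j + 1) - 4)) / (1 - qPow τ (2 * k * (j + 1)))

/-- The vertex operator `λ₁(z)`, `z = exp u`: a scalar times
`:Ȳ⁻(q^{k+2} z) Z₊(q^{(3k+6)/2} z) W₊(q^{(3k+4)/2} z)⁻¹ Ȳ⁺(z) Z₊(q^{-(k+2)/2} z) W₊(q^{-k/2} z):`. -/
def lambda₁ (τ k u : ℂ) : FockOp :=
  (1 / (qPow τ 1 - qPow τ (-1)) ^ 2 * rho τ k u *
    (qPow τ 1 * (1 - qPow τ (-(2 * k) - 4)) / (1 - qPow τ (-(2 * k) - 2)))) •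
  vertexOp τ k
    (yMinus τ k (u + (k + 2) * τ) + zPlus τ (u + (3 * k + 6) / 2 * τ)
      - wPlus τ (u + (3 * k + 4) / 2 * τ)
      + yPlus τ k u + zPlus τ (u - (k + 2) / 2 * τ) + wPlus τ (u - k / 2 * τ))

/-- The vertex operator `λ₂(z)`, `z = exp u`: a scalar times
`:Ȳ⁻(q^{k+2} z) W₋(q^{(k+4)/2} z)⁻¹ Z₋(q^{(k+2)/2} z) Ȳ⁺(z) Z₊(q^{-(k+2)/2} z) W₊(q^{-k/2} z):`. -/
def lambda₂ (τ k u : ℂ) : FockOp :=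
  (-(1 / (qPow τ 1 - qPow τ (-1)) ^ 2) * rho τ k u * qPow τ (-1)) •
  vertexOp τ k
    (yMinus τ k (u + (k + 2) * τ) - wMinus τ (u + (k + 4) / 2 * τ)
      + zMinus τ (u + (k + 2) / 2 * τ)
      + yPlus τ k u + zPlus τ (u - (k + 2) / 2 * τ) + wPlus τ (u - k / 2 * τ))

/-- The vertex operator `λ₃(z)`, `z = exp u`: a scalar times
`:Ȳ⁻(q^{k+2} z) Z₊(q^{(3k+6)/2} z) W₊(q^{(3k+4)/2} z)⁻¹ Ȳ⁺(z) W₋(q^{k/2} z) Z₋(q^{(k+2)/2} z):`. -/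
def lambda₃ (τ k u : ℂ) : FockOp :=
  (-(1 / (qPow τ 1 - qPow τ (-1)) ^ 2) * rho τ k u * qPow τ 1) •
  vertexOp τ k
    (yMinus τ k (u + (k + 2) * τ) + zPlus τ (u + (3 * k + 6) / 2 * τ)
      - wPlus τ (u + (3 * k + 4) / 2 * τ)
      + yPlus τ k u + wMinus τ (u + k / 2 * τ) + zMinus τ (u + (k + 2) / 2 * τ))

/-- Taylor's formula: `expAnnihilation` is the exponential series of `annihilationPart` (only
finitely many terms of which are nonzero on a given polynomial). -/
theorem expAnnihilation_eq (τ k : ℂ) (φ : LinForm) (p : Fock) :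
    (∃ N : ℕ, ∀ n, N ≤ n → (annihilationPart τ k φ)^[n] p = 0) ∧
    expAnnihilation τ k φ p =
      ∑ᶠ n : ℕ, ((n.factorial : ℂ)⁻¹) • (annihilationPart τ k φ)^[n] p := by
  set D := annihilationPart τ k φ with hD
  have key : ∀ p : Fock, ∃ N : ℕ, (∀ n, N ≤ n → D^[n] p = 0) ∧ ∀ K, N ≤ K →
      expAnnihilation τ k φ p =
        ∑ n ∈ Finset.range K, ((n.factorial : ℂ)⁻¹) • D^[n] p := by
    intro p
    induction p using MvPolynomial.induction_on with
    | C a =>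
      have h1 : D (MvPolynomial.C a) = 0 := by
        simp [← MvPolynomial.algebraMap_eq]
      have h2 : ∀ n, 1 ≤ n → D^[n] (MvPolynomial.C a) = 0 := by
        intro n hn
        obtain ⟨m, rfl⟩ := Nat.exists_eq_add_of_le' hn
        rw [Function.iterate_succ_apply, h1]
        exact iterate_map_zero D m
      refine ⟨1, h2, ?_⟩
      intro K hK
      obtain ⟨m, rfl⟩ := Nat.exists_eq_add_of_le' hK
      rw [Finset.sum_range_succ', Finset.sum_eq_zero]
      · simp [expAnnihilation, MvPolynomial.algebraMap_eq]
      · intro n _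
        rw [h2 (n + 1) (by omega), smul_zero]
    | add p r hp hr =>
      obtain ⟨N, h1, h2⟩ := hp
      obtain ⟨N', h3, h4⟩ := hr
      refine ⟨max N N', ?_, ?_⟩
      · intro n hn
        rw [iterate_map_add, h1 n (by omega), h3 n (by omega), add_zero]
      · intro K hK
        rw [map_add, h2 K (by omega), h4 K (by omega), ← Finset.sum_add_distrib]
        refine Finset.sum_congr rfl fun n _ => ?_
        rw [iterate_map_add, smul_add]
    | mul_X p s hp =>
      obtain ⟨N, h1, h2⟩ := hp
      set b : ℂ := φ.1 s.1 ((s.2 : ℕ) : ℤ) * heisenberg τ k s.1 s.2 with hb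
      have hX : D (MvPolynomial.X s) = MvPolynomial.C b := by
        simp [hD, annihilationPart, MvPolynomial.mkDerivation_X, hb]
      have hC : ∀ f : Fock, D (f * MvPolynomial.C b) = D f * MvPolynomial.C b := by
        intro f
        have : D (MvPolynomial.C b) = 0 := by
          simp [← MvPolynomial.algebraMap_eq]
        simp [this, mul_comm]
      have hit : ∀ n : ℕ, D^[n + 1] (p * MvPolynomial.X s) =
          D^[n + 1] p * MvPolynomial.X s + ((n + 1 : ℕ) : ℂ) • (D^[n] p * MvPolynomial.C b) := by
        intro n
        induction n with
        | zero =>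
          simp only [zero_add, Function.iterate_one, Function.iterate_zero, id, Derivation.leibniz,
            hX, smul_eq_mul, Nat.cast_one, one_smul]
          ring
        | succ n ih =>
          rw [Function.iterate_succ_apply' (n := n + 1), ih, map_add, Derivation.leibniz, hX,
            Derivation.map_smul, hC, ← Function.iterate_succ_apply' D, ← Function.iterate_succ_apply' D]
          push_cast
          simp only [smul_eq_mul, add_smul, one_smul]
          ring
      refine ⟨N + 1, ?_, ?_⟩
      · intro n hn
        obtain ⟨m, rfl⟩ := Nat.exists_eq_add_of_le' (show 1 ≤ n by omega)
        rw [hit, h1 _ (by omega), h1 _ (by omega)]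
        simp
      · intro K hK
        obtain ⟨m, rfl⟩ := Nat.exists_eq_add_of_le' (show 1 ≤ K by omega)
        have hE : expAnnihilation τ k φ (MvPolynomial.X s) =
            MvPolynomial.X s + MvPolynomial.C b := by
          simp [expAnnihilation, hb]
        rw [map_mul, hE, mul_add, Finset.sum_range_succ']
        simp only [hit, smul_add, Finset.sum_add_distrib]
        nth_rewrite 1 [h2 (m + 1) (by omega)]
        rw [h2 m (by omega), Finset.sum_range_succ', add_mul, Finset.sum_mul, Finset.sum_mul]
        simp only [smul_mul_assoc, Function.iterate_zero, id, smul_smul]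
        have : ∀ n : ℕ, (((n + 1).factorial : ℂ)⁻¹ * ((n + 1 : ℕ) : ℂ)) =
            ((n.factorial : ℂ)⁻¹) := by
          intro n
          have h3 : ((n.factorial : ℕ) : ℂ) ≠ 0 := by exact_mod_cast n.factorial_ne_zero
          have h4 : ((n + 1 : ℕ) : ℂ) ≠ 0 := by exact_mod_cast n.succ_ne_zero
          rw [Nat.factorial_succ, Nat.cast_mul]
          field_simp
        simp only [this]
        ring
  obtain ⟨N, h1, h2⟩ := key p
  refine ⟨⟨N, h1⟩, ?_⟩
  rw [h2 N le_rfl]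
  symm
  apply finsum_eq_sum_of_support_subset
  intro n hn
  by_contra h
  simp only [Finset.coe_range, Set.mem_Iio, not_lt] at h
  exact hn (by simp [h1 n h])

end

/-! Moving the annihilation part of `:exp φ:` past the creation part of `:exp ψ:` produces a scalar,
so `:exp φ: :exp ψ:` is the exponential of a contraction sum times `:exp (φ + ψ):`
(`hasSum_productTerm_vertexOp`). Each product in `Φ⁻(w) Φ⁺(z)` thus reduces to a scalar series in `x
= z / w`.

With `p = q^{2k}`, the `Ȳ⁻Ȳ⁺` contraction sums to `(q^{k-2} x; p)_∞ / (q^{k+2} x; p)_∞`, and the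
zero modes contribute `w^{2/k} q^{±1}`. The zeroth factor `1 - q^{k+2} x` of the denominator
vanishes simply at `w₀ = q^{k+2} z`. The other contractions only change elementary factors. For
(first)(first), `Z₊Ȳ⁺` inserts `(1 - q^{-k-2} x) / (1 - q^{-k} x)`. For (second)(second), `Ȳ⁻Z₋`
inserts `(1 - q^{k+2} x) / (1 - q^k x)`, which removes the pole. For (first)(second), both of these
occur and are cancelled by the `Z₊Z₋` and `W₊W₋` contractions together (`qTanh_mul_logTerm`); for
(second)(first), nothing is added. Hence exactly three products are singular at `w₀`.

The normally ordered products have matrix elements entire in `log w`, so the contour integral only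
sees the factor `(1 - w₀ / w)⁻¹`, whose residue is `w₀` (`circleIntegral_log_eventually`). The
common factor at `w₀`, times `2πi w₀`, is `ρ(z)` (`rho_eq`). Its numerator factors there are `1 -
q^{2kj-4}`, and genericity says that none of them vanishes; this gives the exact pole orders and
nonzero coefficients. Independence follows from a Vandermonde argument, since the three operators
carry distinct coefficients of `β_{-1}` (`linearIndependent_vertexOp`). -/

open Filter Topology

noncomputable section

/-! ### Exponentials of linear forms as formal power series -/

section MultiExp

variable {σ R : Type*} [CommRing R] [Algebra ℂ R]

/-- The power series `∏ exp (a i X i)`. -/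
def multiExp (a : σ → R) : MvPowerSeries σ R :=
  fun s => s.prod fun i n => ((n.factorial : ℂ)⁻¹) • a i ^ n

theorem coeff_multiExp (a : σ → R) (s : σ →₀ ℕ) :
    MvPowerSeries.coeff s (multiExp a) = s.prod fun i n => ((n.factorial : ℂ)⁻¹) • a i ^ n := rfl

theorem constantCoeff_multiExp (a : σ → R) :
    MvPowerSeries.constantCoeff (multiExp a) = 1 := by
  rw [← MvPowerSeries.coeff_zero_eq_constantCoeff_apply, coeff_multiExp, Finsupp.prod_zero_index]

theorem pderiv_multiExp (a : σ → R) (i : σ) :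
    MvPowerSeries.pderiv R i (multiExp a) = MvPowerSeries.C (a i) * multiExp a := by
  classical
  ext s
  rw [MvPowerSeries.coeff_pderiv, MvPowerSeries.coeff_C_mul, coeff_multiExp, coeff_multiExp,
    ← Finsupp.mul_prod_erase' (s + Finsupp.single i 1) i _ (by simp),
    ← Finsupp.mul_prod_erase' s i _ (by simp)]
  have h1 : Finsupp.erase i (s + Finsupp.single i 1) = Finsupp.erase i s := by
    ext j; by_cases h : j = i <;> simp [h, Finsupp.erase]
  rw [h1]
  simp only [Finsupp.add_apply, Finsupp.single_eq_same]
  have h2 : ((s i : R) + 1) = algebraMap ℂ R ((s i + 1 : ℕ) : ℂ) := by simp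
  have h3 : (((s i + 1 : ℕ) : ℂ)) ≠ 0 := by exact_mod_cast (s i).succ_ne_zero
  have h4 : (((s i).factorial : ℕ) : ℂ) ≠ 0 := by exact_mod_cast (s i).factorial_ne_zero
  rw [h2, mul_comm, ← mul_assoc, ← mul_assoc, mul_smul_comm, ← Algebra.smul_def, smul_smul,
    Nat.factorial_succ, mul_smul_comm, pow_succ', Nat.cast_mul, mul_inv, mul_right_comm,
    inv_mul_cancel₀ h3, one_mul]

variable [IsAddTorsionFree R]

/-- Uniqueness for the system `∂ᵢ F = aᵢ F`: by Leibniz all partial derivatives of this product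
vanish, and over a torsion-free ring a series is determined by its partial derivatives and its
constant term. -/
theorem mul_multiExp_neg (a : σ → R) {F : MvPowerSeries σ R}
    (h0 : MvPowerSeries.constantCoeff F = 1)
    (hF : ∀ i, MvPowerSeries.pderiv R i F = MvPowerSeries.C (a i) * F) :
    F * multiExp (-a) = 1 := by
  refine MvPowerSeries.pderiv.ext (fun i => ?_) (by simp [h0, constantCoeff_multiExp])
  rw [Derivation.leibniz, hF, pderiv_multiExp, MvPowerSeries.pderiv_one]
  simp only [smul_eq_mul, Pi.neg_apply, map_neg]
  ring

theorem eq_multiExp (a : σ → R) {F : MvPowerSeries σ R}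
    (h0 : MvPowerSeries.constantCoeff F = 1)
    (hF : ∀ i, MvPowerSeries.pderiv R i F = MvPowerSeries.C (a i) * F) :
    F = multiExp a := by
  have h1 := mul_multiExp_neg a h0 hF
  have h2 := mul_multiExp_neg a (constantCoeff_multiExp a) (pderiv_multiExp a)
  calc F = F * (multiExp a * multiExp (-a)) := by rw [h2, mul_one]
    _ = multiExp a * (F * multiExp (-a)) := by ring
    _ = multiExp a := by rw [h1, mul_one]

/-- Logarithmic derivatives add. A general coefficient ring is needed because
`smul_translation_monomial` applies this with polynomial coefficients. -/
theorem multiExp_add (a b : σ → R) : multiExp (a + b) = multiExp a * multiExp b := by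
  refine (eq_multiExp _ (by simp [constantCoeff_multiExp]) fun i => ?_).symm
  rw [Derivation.leibniz, pderiv_multiExp, pderiv_multiExp]
  simp only [smul_eq_mul, Pi.add_apply, map_add]
  ring

end MultiExp

/-! ### The sum of all coefficients of an exponential series -/

section Sum

variable {σ : Type*}

theorem norm_coeff_multiExp (c : σ → ℂ) (s : σ →₀ ℕ) :
    ((‖MvPowerSeries.coeff s (multiExp c)‖ : ℝ) : ℂ) =
      MvPowerSeries.coeff s (multiExp fun i => ((‖c i‖ : ℝ) : ℂ)) := by
  rw [coeff_multiExp, coeff_multiExp, Finsupp.prod, Finsupp.prod, norm_prod, Complex.ofReal_prod]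
  refine Finset.prod_congr rfl fun i _ => ?_
  simp

theorem coeff_multiExp_eq_zero {c : σ → ℂ} {s : σ →₀ ℕ} {i : σ} (hi : s i ≠ 0) (hc : c i = 0) :
    MvPowerSeries.coeff s (multiExp c) = 0 := by
  rw [coeff_multiExp, Finsupp.prod]
  refine Finset.prod_eq_zero (Finsupp.mem_support_iff.mpr hi) ?_
  simp [hc, hi]

open Finset.HasAntidiagonal in
theorem hasSum_antidiagonal_of_summable_norm {A : Type*} [AddCommMonoid A]
    [Finset.HasAntidiagonal A] {f g : A → ℂ} (hf : Summable fun s => ‖f s‖)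
    (hg : Summable fun s => ‖g s‖) :
    Summable (fun s => ‖∑ p ∈ antidiagonal s, f p.1 * g p.2‖) ∧
    HasSum (fun s => ∑ p ∈ antidiagonal s, f p.1 * g p.2) ((∑' s, f s) * ∑' s, g s) := by
  have hprod : Summable fun x : A × A => f x.1 * g x.2 :=
    summable_mul_of_summable_norm (f := f) (g := g) hf hg
  have hprod' : Summable fun x : A × A => ‖f x.1‖ * ‖g x.2‖ :=
    Summable.mul_of_nonneg (f := fun s => ‖f s‖) (g := fun s => ‖g s‖) hf hg
      (fun s => norm_nonneg (f s)) (fun s => norm_nonneg (g s))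
  have hS : Summable (fun s => ‖∑ p ∈ antidiagonal s, f p.1 * g p.2‖) := by
    have h := summable_sum_mul_antidiagonal_of_summable_mul (f := fun s => ‖f s‖)
      (g := fun s => ‖g s‖) hprod'
    refine h.of_nonneg_of_le
      (fun _ => norm_nonneg _) fun s => ?_
    exact (norm_sum_le _ _).trans (Finset.sum_le_sum fun p _ => norm_mul_le _ _)
  refine ⟨hS, ?_⟩
  rw [hf.of_norm.tsum_mul_tsum_eq_tsum_sum_antidiagonal hg.of_norm hprod]
  exact hS.of_norm.hasSum

open Classical in
-- Induction on `S`: a new variable multiplies the series by a one-variable exponential, supported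
-- on the multiples of one unit vector, and the Cauchy product of absolutely summable families
-- multiplies the sums.
theorem hasSum_multiExp_finset (c : σ → ℂ) (S : Finset σ) :
    Summable (fun s => ‖MvPowerSeries.coeff s (multiExp fun i => if i ∈ S then c i else 0)‖) ∧
    HasSum (fun s => MvPowerSeries.coeff s (multiExp fun i => if i ∈ S then c i else 0))
      (Complex.exp (∑ i ∈ S, c i)) := by
  induction S using Finset.induction_on with
  | empty =>
    have h : ∀ s : σ →₀ ℕ, s ≠ 0 →
        MvPowerSeries.coeff s (multiExp fun i => if i ∈ (∅ : Finset σ) then c i else 0) = 0 := by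
      intro s hs
      obtain ⟨i, hi⟩ := Finsupp.ne_iff.mp hs
      exact coeff_multiExp_eq_zero (i := i) hi (by simp)
    have h1 := hasSum_single 0 h
    have h2 := hasSum_single (f := fun s => ‖MvPowerSeries.coeff s
      (multiExp fun i => if i ∈ (∅ : Finset σ) then c i else 0)‖) 0
      (fun s hs => by rw [h s hs, norm_zero])
    refine ⟨h2.summable, ?_⟩
    simpa [constantCoeff_multiExp] using h1
  | insert j S hj ih =>
    have hsplit : (fun i => if i ∈ insert j S then c i else 0) =
        (fun i => if i = j then c i else 0) + fun i => if i ∈ S then c i else 0 := by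
      funext i
      by_cases h : i = j
      · subst h; simp [hj]
      · simp [h]
    have hinj : Function.Injective (Finsupp.single j : ℕ → σ →₀ ℕ) := Finsupp.single_injective j
    have hz : ∀ s ∉ Set.range (Finsupp.single j : ℕ → σ →₀ ℕ),
        MvPowerSeries.coeff s (multiExp fun i => if i = j then c i else 0) = 0 := by
      intro s hs
      by_contra hne
      refine hs ⟨s j, ?_⟩
      ext i
      by_cases h : i = j
      · subst h; simp
      · rw [Finsupp.single_eq_of_ne h]
        by_contra h2
        exact hne (coeff_multiExp_eq_zero (i := i) (fun h3 => h2 h3.symm) (by simp [h]))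
    have hval : ∀ n : ℕ, MvPowerSeries.coeff (Finsupp.single j n)
        (multiExp fun i => if i = j then c i else 0) = c j ^ n / n.factorial := by
      intro n
      rw [coeff_multiExp, Finsupp.prod_single_index (by simp)]
      simp [div_eq_inv_mul]
    have hs1 : HasSum (fun s => MvPowerSeries.coeff s (multiExp fun i => if i = j then c i else 0))
        (Complex.exp (c j)) := by
      rw [← hinj.hasSum_iff hz]
      simp only [Function.comp_def, hval]
      rw [Complex.exp_eq_exp_ℂ]
      exact NormedSpace.expSeries_div_hasSum_exp (c j)
    have hs2 : Summable
        (fun s => ‖MvPowerSeries.coeff s (multiExp fun i => if i = j then c i else 0)‖) := by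
      rw [← hinj.summable_iff (fun s hs => by rw [hz s hs, norm_zero])]
      simp only [Function.comp_def, hval]
      exact NormedSpace.norm_expSeries_div_summable (c j)
    have hco : ∀ s, MvPowerSeries.coeff s (multiExp fun i => if i ∈ insert j S then c i else 0) =
        ∑ p ∈ Finset.HasAntidiagonal.antidiagonal s,
          MvPowerSeries.coeff p.1 (multiExp fun i => if i = j then c i else 0) *
          MvPowerSeries.coeff p.2 (multiExp fun i => if i ∈ S then c i else 0) := by
      intro s
      rw [hsplit, multiExp_add, MvPowerSeries.coeff_mul]
    have h := hasSum_antidiagonal_of_summable_norm hs2 ih.1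
    rw [hs1.tsum_eq, ih.2.tsum_eq, ← Complex.exp_add, ← Finset.sum_insert hj] at h
    simpa only [← hco] using h

open Classical in
-- A finite set of exponents involves only finitely many variables, so its partial sum of norms is
-- at most a finite-variable exponential of the `‖c i‖`, hence at most `exp (∑ ‖c i‖)`.
theorem summable_norm_multiExp {c : σ → ℂ} (hc : Summable fun i => ‖c i‖) :
    Summable fun s => ‖MvPowerSeries.coeff s (multiExp c)‖ := by
  refine summable_of_sum_le (c := Real.exp (∑' i, ‖c i‖)) (fun _ => norm_nonneg _) fun T => ?_
  set S : Finset σ := T.biUnion Finsupp.support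
  have h1 := hasSum_multiExp_finset (fun i => ((‖c i‖ : ℝ) : ℂ)) S
  have h2 : HasSum (fun s => ‖MvPowerSeries.coeff s
      (multiExp fun i => if i ∈ S then c i else 0)‖) (Real.exp (∑ i ∈ S, ‖c i‖)) := by
    have h3 := h1.2
    rw [← Complex.ofReal_sum, ← Complex.ofReal_exp] at h3
    rw [← Complex.hasSum_ofReal]
    convert h3 using 2 with s
    rw [norm_coeff_multiExp]
    congr 2
    funext i
    split_ifs <;> simp
  have h4 : ∑ s ∈ T, ‖MvPowerSeries.coeff s (multiExp c)‖ =
      ∑ s ∈ T, ‖MvPowerSeries.coeff s (multiExp fun i => if i ∈ S then c i else 0)‖ := by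
    refine Finset.sum_congr rfl fun s hs => ?_
    rw [coeff_multiExp, coeff_multiExp]
    congr 1
    refine Finset.prod_congr rfl fun i hi => ?_
    simp only [show i ∈ S from Finset.mem_biUnion.mpr ⟨s, hs, hi⟩, if_true]
  rw [h4]
  refine (sum_le_hasSum T (fun _ _ => norm_nonneg _) h2).trans ?_
  exact Real.exp_le_exp.mpr (hc.sum_le_tsum S fun _ _ => norm_nonneg _)

open Classical in
/-- The sum of all coefficients of `∏ exp (c i X i)` is `exp (∑ c i)`. -/
theorem hasSum_multiExp {c : σ → ℂ} (hc : Summable fun i => ‖c i‖) :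
    HasSum (fun s => MvPowerSeries.coeff s (multiExp c)) (Complex.exp (∑' i, c i)) := by
  have hS := summable_norm_multiExp hc
  -- Dominated convergence: setting the variables outside `S` to zero either leaves a coefficient
  -- unchanged or kills it, and leaves it unchanged once `S` contains its support.
  have h1 : Tendsto (fun S : Finset σ => ∑' s, MvPowerSeries.coeff s
      (multiExp fun i => if i ∈ S then c i else 0)) atTop
      (𝓝 (∑' s, MvPowerSeries.coeff s (multiExp c))) := by
    refine tendsto_tsum_of_dominated_convergence hS (fun s => ?_) (.of_forall fun S s => ?_)
    · refine tendsto_const_nhds.congr' ?_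
      filter_upwards [eventually_ge_atTop s.support] with S hSs
      rw [coeff_multiExp, coeff_multiExp]
      refine Finset.prod_congr rfl fun i hi => ?_
      simp only [show i ∈ S from hSs hi, if_true]
    · by_cases h : ∀ i ∈ s.support, i ∈ S
      · apply le_of_eq
        rw [coeff_multiExp, coeff_multiExp]
        congr 1
        refine Finset.prod_congr rfl fun i hi => ?_
        simp only [h i hi, if_true]
      · push Not at h
        obtain ⟨i, hi, hiS⟩ := h
        rw [coeff_multiExp_eq_zero (i := i) (Finsupp.mem_support_iff.mp hi) (by simp [hiS]),
          norm_zero]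
        exact norm_nonneg _
  have h2 : Tendsto (fun S : Finset σ => Complex.exp (∑ i ∈ S, c i)) atTop
      (𝓝 (Complex.exp (∑' i, c i))) :=
    (Complex.continuous_exp.tendsto _).comp hc.of_norm.hasSum
  have h3 := tendsto_nhds_unique (h2.congr fun S => (hasSum_multiExp_finset c S).2.tsum_eq.symm) h1
  rw [h3]
  exact hS.of_norm.hasSum

end Sum

/-! ### Termwise translation of power series -/

section Translation

variable {σ : Type*}

theorem coeff_multiExp_eq_smul {R : Type*} [CommRing R] [Algebra ℂ R] (a : σ → R) (s : σ →₀ ℕ) :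
    MvPowerSeries.coeff s (multiExp a) =
      (s.prod fun _ n => ((n.factorial : ℂ)⁻¹)) • s.prod fun i n => a i ^ n := by
  rw [coeff_multiExp, Finsupp.prod, Finsupp.prod, Finsupp.prod, Finset.prod_smul]

theorem coeff_multiExp_mul (a b : σ → ℂ) (s : σ →₀ ℕ) :
    MvPowerSeries.coeff s (multiExp (a * b)) =
      MvPowerSeries.coeff s (multiExp a) * s.prod fun i n => b i ^ n := by
  rw [coeff_multiExp, coeff_multiExp, Finsupp.prod, Finsupp.prod, Finsupp.prod,
    ← Finset.prod_mul_distrib]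
  refine Finset.prod_congr rfl fun i _ => ?_
  simp [mul_pow, mul_assoc]

/-- The translation `X i ↦ X i + a i` of polynomials. -/
def translation (a : σ → ℂ) : MvPolynomial σ ℂ →ₐ[ℂ] MvPolynomial σ ℂ :=
  MvPolynomial.aeval fun i => MvPolynomial.X i + MvPolynomial.C (a i)

theorem translation_monomial (a : σ → ℂ) (s : σ →₀ ℕ) :
    translation a (MvPolynomial.monomial s 1) =
      s.prod fun i n => (MvPolynomial.X i + MvPolynomial.C (a i)) ^ n := by
  rw [translation, MvPolynomial.aeval_monomial, map_one, one_mul]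

theorem translation_comp (a b : σ → ℂ) (p : MvPolynomial σ ℂ) :
    translation a (translation b p) = translation (a + b) p := by
  rw [← AlgHom.comp_apply]
  congr 1
  refine MvPolynomial.algHom_ext fun i => ?_
  simp [translation, add_assoc]

open Classical in
-- The multivariate binomial theorem: `(X + a)^s / s!` is the coefficient at `s` of the exponential
-- series with parameters `X i + a i`, and `multiExp_add` splits it.
theorem smul_translation_monomial (a : σ → ℂ) (s : σ →₀ ℕ) :
    (s.prod fun _ n => ((n.factorial : ℂ)⁻¹)) • translation a (MvPolynomial.monomial s 1) =
      ∑ p ∈ Finset.HasAntidiagonal.antidiagonal s, MvPolynomial.monomial p.1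
        ((p.1.prod fun _ n => ((n.factorial : ℂ)⁻¹)) * MvPowerSeries.coeff p.2 (multiExp a)) := by
  rw [translation_monomial, ← coeff_multiExp_eq_smul]
  have h : (fun i => (MvPolynomial.X i + MvPolynomial.C (a i) : MvPolynomial σ ℂ)) =
      (fun i => MvPolynomial.X i) + fun i => MvPolynomial.C (a i) := rfl
  rw [h, multiExp_add, MvPowerSeries.coeff_mul]
  refine Finset.sum_congr rfl fun p _ => ?_
  have h1 : MvPowerSeries.coeff p.2 (multiExp fun i => (MvPolynomial.C (a i) : MvPolynomial σ ℂ)) =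
      MvPolynomial.C (MvPowerSeries.coeff p.2 (multiExp a)) := by
    rw [coeff_multiExp, coeff_multiExp, Finsupp.prod, Finsupp.prod, map_prod]
    refine Finset.prod_congr rfl fun i _ => ?_
    rw [smul_eq_mul, MvPolynomial.C_mul, MvPolynomial.smul_eq_C_mul, map_pow]
  rw [h1, coeff_multiExp_eq_smul, MvPolynomial.monomial_eq, MvPolynomial.C_mul,
    MvPolynomial.smul_eq_C_mul]
  ring

open Classical in
-- The factorial `s!` in the exponential coefficient absorbs the binomial coefficient, so the
-- dependence on `t` and on `s - t` separates.
theorem coeff_multiExp_mul_coeff_translation (a b : σ → ℂ) (s t : σ →₀ ℕ) :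
    MvPowerSeries.coeff s (multiExp b) *
        MvPolynomial.coeff t (translation a (MvPolynomial.monomial s 1)) =
      if t ≤ s then MvPowerSeries.coeff t (multiExp b) *
        MvPowerSeries.coeff (s - t) (multiExp (a * b)) else 0 := by
  have h := congrArg (MvPolynomial.coeff t) (smul_translation_monomial a s)
  rw [MvPolynomial.coeff_smul, MvPolynomial.coeff_sum] at h
  simp only [MvPolynomial.coeff_monomial] at h
  rw [smul_eq_mul] at h
  rw [coeff_multiExp_eq_smul, smul_eq_mul, mul_right_comm, h]
  split_ifs with hts
  · obtain ⟨r, rfl⟩ := exists_add_of_le hts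
    rw [Finset.sum_eq_single (t, r), if_pos rfl, add_tsub_cancel_left, coeff_multiExp_mul,
      Finsupp.prod_add_index' (by simp) (fun _ _ _ => pow_add _ _ _), coeff_multiExp_eq_smul b t,
      smul_eq_mul]
    · ring
    · rintro ⟨x, y⟩ hxy hne
      refine if_neg fun h1 : x = t => hne ?_
      rw [Finset.HasAntidiagonal.mem_antidiagonal] at hxy
      subst h1
      exact Prod.ext rfl (add_left_cancel hxy)
    · intro h1
      exact absurd (by rw [Finset.HasAntidiagonal.mem_antidiagonal]) h1
  · rw [Finset.sum_eq_zero, zero_mul]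
    rintro ⟨x, y⟩ hxy
    refine if_neg fun h1 : x = t => hts ?_
    rw [Finset.HasAntidiagonal.mem_antidiagonal] at hxy
    exact h1 ▸ hxy ▸ le_self_add

/-- Termwise translation of the power series `f` by `a` converges coefficientwise to `g`. -/
def IsTranslate (a : σ → ℂ) (f g : MvPowerSeries σ ℂ) : Prop :=
  ∀ t, HasSum (fun s => MvPowerSeries.coeff s f *
    MvPolynomial.coeff t (translation a (MvPolynomial.monomial s 1))) (MvPowerSeries.coeff t g)

/-- This is the exchange of an annihilation exponential with a creation exponential. Writing `s = t
+ r`, the sum over `r` runs over all coefficients of an exponential series with parameters `a i * b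
i`; its value is the contraction factor. -/
theorem isTranslate_multiExp {a b : σ → ℂ} (hab : Summable fun i => ‖a i * b i‖) :
    IsTranslate a (multiExp b) (Complex.exp (∑' i, a i * b i) • multiExp b) := by
  classical
  intro t
  simp only [coeff_multiExp_mul_coeff_translation]
  rw [← (add_right_injective t).hasSum_iff]
  · simp only [Function.comp_def, le_add_iff_nonneg_right, zero_le, if_true, add_tsub_cancel_left,
      map_smul, smul_eq_mul]
    rw [mul_comm (Complex.exp _)]
    have h : HasSum (fun s => MvPowerSeries.coeff s (multiExp (a * b)))
        (Complex.exp (∑' i, a i * b i)) := hasSum_multiExp (c := a * b) hab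
    exact HasSum.mul_left (MvPowerSeries.coeff t (multiExp b)) h
  · intro s hs
    rw [if_neg]
    intro h
    obtain ⟨r, rfl⟩ := exists_add_of_le h
    exact hs ⟨r, rfl⟩

theorem IsTranslate.add {a : σ → ℂ} {f g f' g' : MvPowerSeries σ ℂ} (h : IsTranslate a f g)
    (h' : IsTranslate a f' g') : IsTranslate a (f + f') (g + g') := by
  intro t
  simpa only [map_add, add_mul] using (h t).add (h' t)

theorem IsTranslate.smul {a : σ → ℂ} {f g : MvPowerSeries σ ℂ} (h : IsTranslate a f g) (c : ℂ) :
    IsTranslate a (c • f) (c • g) := by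
  intro t
  simpa only [map_smul, smul_eq_mul, mul_assoc] using (h t).mul_left c

theorem IsTranslate.mul_X {a : σ → ℂ} {f g : MvPowerSeries σ ℂ} (h : IsTranslate a f g) (i : σ) :
    IsTranslate a (f * MvPowerSeries.X i)
      (g * (MvPowerSeries.X i + MvPowerSeries.C (a i))) := by
  classical
  intro t
  rw [← (add_left_injective (Finsupp.single i 1)).hasSum_iff]
  · have h1 : ∀ s : σ →₀ ℕ, translation a (MvPolynomial.monomial (s + Finsupp.single i 1) 1) =
        translation a (MvPolynomial.monomial s 1) * MvPolynomial.X i +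
          MvPolynomial.C (a i) * translation a (MvPolynomial.monomial s 1) := by
      intro s
      rw [translation_monomial, translation_monomial,
        Finsupp.prod_add_index' (by simp) (fun _ _ _ => pow_add _ _ _),
        Finsupp.prod_single_index (by simp), pow_one]
      ring
    have h3 : ∀ s : σ →₀ ℕ, MvPowerSeries.coeff (s + Finsupp.single i 1) (f * MvPowerSeries.X i) =
        MvPowerSeries.coeff s f := by
      intro s
      rw [MvPowerSeries.X_def, MvPowerSeries.coeff_add_mul_monomial, mul_one]
    have h4 : MvPowerSeries.coeff t (g * (MvPowerSeries.X i + MvPowerSeries.C (a i))) =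
        (if Finsupp.single i 1 ≤ t then MvPowerSeries.coeff (t - Finsupp.single i 1) g else 0) +
          a i * MvPowerSeries.coeff t g := by
      rw [mul_add, map_add, MvPowerSeries.X_def, MvPowerSeries.coeff_mul_monomial,
        MvPowerSeries.coeff_mul_C, mul_one, mul_comm (a i)]
    rw [h4]
    simp only [Function.comp_def, h1, h3, MvPolynomial.coeff_add, MvPolynomial.coeff_C_mul,
      MvPolynomial.coeff_mul_X', mul_add, mul_left_comm _ (a i)]
    refine HasSum.add ?_ ((h t).mul_left (a i))
    by_cases hi : i ∈ t.support
    · have h2 : Finsupp.single i 1 ≤ t := by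
        rw [Finsupp.single_le_iff]; exact Nat.one_le_iff_ne_zero.mpr (Finsupp.mem_support_iff.mp hi)
      simpa only [hi, h2, if_true] using h (t - Finsupp.single i 1)
    · have h2 : ¬ Finsupp.single i 1 ≤ t := by
        rw [Finsupp.single_le_iff, Finsupp.notMem_support_iff.mp hi]; simp
      simp only [hi, h2, if_false, mul_zero]
      exact hasSum_zero
  · intro s hs
    rw [MvPowerSeries.X_def, MvPowerSeries.coeff_mul_monomial, if_neg, zero_mul]
    intro h
    obtain ⟨r, rfl⟩ := exists_add_of_le h
    exact hs ⟨r, add_comm _ _⟩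

/-- Extends the exchange from the vacuum to an arbitrary polynomial state: translation is
multiplicative, and multiplication by a variable is a reindexing of the sum. -/
theorem IsTranslate.mul_coe {a : σ → ℂ} {f g : MvPowerSeries σ ℂ} (h : IsTranslate a f g)
    (p : MvPolynomial σ ℂ) :
    IsTranslate a (f * (p : MvPowerSeries σ ℂ)) (g * (translation a p : MvPowerSeries σ ℂ)) := by
  induction p using MvPolynomial.induction_on with
  | C c =>
    have h1 : translation a (MvPolynomial.C c) = MvPolynomial.C c := by
      rw [← MvPolynomial.algebraMap_eq]; exact AlgHom.commutes _ _
    rw [h1, MvPolynomial.coe_C, mul_comm, mul_comm g, ← MvPowerSeries.smul_eq_C_mul,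
      ← MvPowerSeries.smul_eq_C_mul]
    exact h.smul c
  | add p q hp hq =>
    rw [map_add, MvPolynomial.coe_add, MvPolynomial.coe_add, mul_add, mul_add]
    exact hp.add hq
  | mul_X p i hp =>
    have h1 : translation a (MvPolynomial.X i) = MvPolynomial.X i + MvPolynomial.C (a i) := by
      simp [translation]
    rw [map_mul, h1, MvPolynomial.coe_mul, MvPolynomial.coe_mul, MvPolynomial.coe_add,
      MvPolynomial.coe_X, MvPolynomial.coe_C, ← mul_assoc, ← mul_assoc]
    exact hp.mul_X i

end Translation

/-! ### Products of normally ordered exponentials -/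

/-- The coefficients `φ_{i,-m}` of the creation operators. -/
def LinForm.creationCoeff (φ : LinForm) (i : Mode) : ℂ := φ.1 i.1 (-((i.2 : ℕ) : ℤ))

/-- The numbers `φ_{i,m} [i_m, i_{-m}]`. -/
def LinForm.annihilationShift (τ k : ℂ) (φ : LinForm) (i : Mode) : ℂ :=
  φ.1 i.1 ((i.2 : ℕ) : ℤ) * heisenberg τ k i.1 i.2

/-- The eigenvalue of `∑ φ_{i,0} i_0` on the Fock module with label `c`. -/
def LinForm.zeroMode (φ : LinForm) (c : Charge) : ℂ :=
  φ.1 .alpha 0 * zeroEigenvalue c .alpha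
      + φ.1 .alphaBar 0 * zeroEigenvalue c .alphaBar + φ.1 .beta 0 * zeroEigenvalue c .beta

theorem expCreation_eq_multiExp (φ : LinForm) : expCreation φ = multiExp φ.creationCoeff := by
  ext s
  rw [coeff_multiExp]
  refine Finset.prod_congr rfl fun i _ => ?_
  simp [LinForm.creationCoeff, div_eq_inv_mul]

theorem expAnnihilation_eq_translation (τ k : ℂ) (φ : LinForm) :
    expAnnihilation τ k φ = translation (φ.annihilationShift τ k) := rfl

theorem expCreation_add (φ ψ : LinForm) :
    expCreation (φ + ψ) = expCreation φ * expCreation ψ := by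
  rw [expCreation_eq_multiExp, expCreation_eq_multiExp, expCreation_eq_multiExp, ← multiExp_add]
  rfl

theorem expAnnihilation_add (τ k : ℂ) (φ ψ : LinForm) (p : Fock) :
    expAnnihilation τ k φ (expAnnihilation τ k ψ p) = expAnnihilation τ k (φ + ψ) p := by
  rw [expAnnihilation_eq_translation, expAnnihilation_eq_translation,
    expAnnihilation_eq_translation, translation_comp]
  have h : φ.annihilationShift τ k + ψ.annihilationShift τ k =
      (φ + ψ).annihilationShift τ k := by
    funext i
    simp [LinForm.annihilationShift, add_mul]
  rw [h]

theorem LinForm.zeroMode_add_left (φ ψ : LinForm) (c : Charge) :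
    (φ + ψ).zeroMode c = φ.zeroMode c + ψ.zeroMode c := by
  simp only [LinForm.zeroMode, Prod.fst_add, Pi.add_apply]
  ring

theorem LinForm.zeroMode_add_right (φ : LinForm) (c d : Charge) :
    φ.zeroMode (c + d) = φ.zeroMode c + φ.zeroMode d := by
  simp only [LinForm.zeroMode, zeroEigenvalue, Pi.add_apply]
  ring

open Classical in
theorem matrixElement_vertexOp_single (τ k : ℂ) (φ : LinForm) (c : Charge) (p : Fock) (d : Charge)
    (t : Mode →₀ ℕ) :
    matrixElement (vertexOp τ k φ) (Finsupp.single c p) d t =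
      if d = c + (1 / 2 : ℂ) • φ.2 then Complex.exp (φ.zeroMode c) *
        MvPowerSeries.coeff t (expCreation φ * (expAnnihilation τ k φ p : FockHat)) else 0 := by
  rw [matrixElement, vertexOp, Finsupp.lsum_single]
  simp only [LinearMap.smul_apply, LinearMap.comp_apply, Pi.smul_apply, LinearMap.single_apply,
    map_smul, smul_eq_mul, AlgHom.toLinearMap_apply, LinearMap.mulLeft_apply,
    MvPolynomial.coeToMvPowerSeries.algHom_apply, LinForm.zeroMode, Algebra.algebraMap_self,
    MvPowerSeries.map_id, RingHom.id_apply]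
  split_ifs with h
  · subst h
    rw [Pi.single_eq_same]
  · rw [Pi.single_eq_of_ne h]
    simp

theorem matrixElement_add_right (A : FockOp) (v v' : FockSum) (d : Charge) (t : Mode →₀ ℕ) :
    matrixElement A (v + v') d t = matrixElement A v d t + matrixElement A v' d t := by
  simp [matrixElement]

theorem matrixElement_zero_right (A : FockOp) (d : Charge) (t : Mode →₀ ℕ) :
    matrixElement A 0 d t = 0 := by
  simp [matrixElement]

theorem matrixElement_add_left (A B : FockOp) (v : FockSum) (d : Charge) (t : Mode →₀ ℕ) :
    matrixElement (A + B) v d t = matrixElement A v d t + matrixElement B v d t := by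
  simp [matrixElement]

theorem matrixElement_sub_left (A B : FockOp) (v : FockSum) (d : Charge) (t : Mode →₀ ℕ) :
    matrixElement (A - B) v d t = matrixElement A v d t - matrixElement B v d t := by
  simp [matrixElement]

theorem matrixElement_smul_left (c : ℂ) (A : FockOp) (v : FockSum) (d : Charge) (t : Mode →₀ ℕ) :
    matrixElement (c • A) v d t = c * matrixElement A v d t := by
  simp [matrixElement]

open Classical in
/-- The product of two normally ordered exponentials. -/
theorem hasSum_productTerm_vertexOp {τ k : ℂ} {φ ψ : LinForm}
    (h : Summable fun i => ‖φ.annihilationShift τ k i * ψ.creationCoeff i‖)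
    (v : FockSum) (d : Charge) (t : Mode →₀ ℕ) :
    HasSum (productTerm (vertexOp τ k φ) (vertexOp τ k ψ) v d t)
      (Complex.exp (∑' i, φ.annihilationShift τ k i * ψ.creationCoeff i) *
        Complex.exp (φ.zeroMode ((1 / 2 : ℂ) • ψ.2)) *
        matrixElement (vertexOp τ k (φ + ψ)) v d t) := by
  induction v using Finsupp.induction_linear with
  | zero =>
    have : productTerm (vertexOp τ k φ) (vertexOp τ k ψ) 0 d t = fun _ => 0 := by
      funext s
      rw [productTerm, matrixElement_zero_right _ s.1 s.2, mul_zero]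
    rw [this, matrixElement_zero_right, mul_zero]
    exact hasSum_zero
  | add v v' hv hv' =>
    have : productTerm (vertexOp τ k φ) (vertexOp τ k ψ) (v + v') d t = fun s =>
        productTerm (vertexOp τ k φ) (vertexOp τ k ψ) v d t s +
        productTerm (vertexOp τ k φ) (vertexOp τ k ψ) v' d t s := by
      funext s
      rw [productTerm, productTerm, productTerm, matrixElement_add_right, mul_add]
    rw [this, matrixElement_add_right, mul_add]
    exact hv.add hv'
  | single c p =>
    -- Only intermediate states in the single Fock module reached by the shift of `ψ` contribute.
    have hinj : Function.Injective fun s : Mode →₀ ℕ => (c + (1 / 2 : ℂ) • ψ.2, s) :=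
      fun s s' hs => congrArg Prod.snd hs
    rw [← hinj.hasSum_iff]
    · simp only [Function.comp_def, productTerm, matrixElement_vertexOp_single, if_true]
      have hcharge : c + (1 / 2 : ℂ) • (φ + ψ).2 =
          c + (1 / 2 : ℂ) • ψ.2 + (1 / 2 : ℂ) • φ.2 := by
        rw [Prod.snd_add, smul_add, add_assoc, add_comm ((1 / 2 : ℂ) • φ.2)]
      rw [hcharge]
      split_ifs with hd
      · have hT := (isTranslate_multiExp h).mul_coe (expAnnihilation τ k ψ p)
        rw [← expCreation_eq_multiExp, ← expAnnihilation_eq_translation, expAnnihilation_add] at hT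
        -- The left factor `expCreation φ` enters a fixed coefficient through finitely many
        -- splittings of `t`, so the exchange formula can be summed over them.
        have hsum : HasSum (fun s => ∑ x ∈ Finset.HasAntidiagonal.antidiagonal t,
            MvPowerSeries.coeff x.1 (expCreation φ) *
            (MvPowerSeries.coeff s (expCreation ψ * (expAnnihilation τ k ψ p : FockHat)) *
              MvPolynomial.coeff x.2 (translation (φ.annihilationShift τ k)
                (MvPolynomial.monomial s 1)))) _ :=
          hasSum_sum fun x _ => (hT x.2).mul_left (MvPowerSeries.coeff x.1 (expCreation φ))
        rw [← MvPowerSeries.coeff_mul] at hsum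
        have hsum' := (hsum.mul_left (Complex.exp (φ.zeroMode (c + (1 / 2 : ℂ) • ψ.2)))).mul_left
          (Complex.exp (ψ.zeroMode c))
        convert hsum' using 1
        · rfl
        · funext s
          rw [MvPowerSeries.coeff_mul, Finset.mul_sum, Finset.sum_mul, Finset.mul_sum,
            Finset.mul_sum]
          refine Finset.sum_congr rfl fun x _ => ?_
          rw [MvPolynomial.coeff_coe, expAnnihilation_eq_translation]
          ring
        -- The zero mode of `φ` is evaluated on the label already shifted by `ψ`; additivity splits
        -- off the factor that belongs to the correlation function.
        · rw [smul_mul_assoc, mul_smul_comm, map_smul, smul_eq_mul, expCreation_add,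
            LinForm.zeroMode_add_left, LinForm.zeroMode_add_right, Complex.exp_add,
            Complex.exp_add, mul_assoc (expCreation φ)]
          ring
      · simp only [zero_mul, mul_zero]
        exact hasSum_zero
    · rintro ⟨c', s⟩ hs
      rw [productTerm, matrixElement_vertexOp_single τ k ψ, if_neg, mul_zero]
      rintro rfl
      exact hs ⟨s, rfl⟩

/-! ### The infinite q-Pochhammer symbol -/

/-- The infinite `q`-Pochhammer symbol `(y; p)_∞ = ∏_{j ≥ 0} (1 - y p ^ j)`. -/
def qPochhammer (p y : ℂ) : ℂ := ∏' j : ℕ, (1 - y * p ^ j)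

theorem summable_norm_mul_pow {p : ℂ} (hp : ‖p‖ < 1) (y : ℂ) :
    Summable fun j : ℕ => ‖-(y * p ^ j)‖ := by
  simpa using (summable_geometric_of_lt_one (norm_nonneg p) hp).mul_left ‖y‖

theorem hasProd_qPochhammer {p : ℂ} (hp : ‖p‖ < 1) (y : ℂ) :
    HasProd (fun j : ℕ => 1 - y * p ^ j) (qPochhammer p y) := by
  have h := multipliable_one_add_of_summable (summable_norm_mul_pow hp y)
  simp only [← sub_eq_add_neg] at h
  exact h.hasProd

theorem qPochhammer_eq {p : ℂ} (hp : ‖p‖ < 1) (y : ℂ) :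
    qPochhammer p y = (1 - y) * qPochhammer p (y * p) := by
  have h : Multipliable fun j : ℕ => 1 - y * p ^ (j + 1) := by
    simpa only [mul_assoc, ← pow_succ'] using (hasProd_qPochhammer hp (y * p)).multipliable
  rw [qPochhammer, tprod_eq_zero_mul' (f := fun j : ℕ => 1 - y * p ^ j) h, qPochhammer]
  simp only [mul_assoc, ← pow_succ', pow_zero, mul_one]

theorem qPochhammer_ne_zero {p : ℂ} (hp : ‖p‖ < 1) {y : ℂ} (hy : ∀ j : ℕ, y * p ^ j ≠ 1) :
    qPochhammer p y ≠ 0 := by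
  have h := tprod_one_add_ne_zero_of_summable (f := fun j : ℕ => -(y * p ^ j))
    (fun j h0 => hy j (by linear_combination -h0)) (summable_norm_mul_pow hp y)
  simp only [← sub_eq_add_neg] at h
  exact h

theorem differentiable_qPochhammer {p : ℂ} (hp : ‖p‖ < 1) : Differentiable ℂ (qPochhammer p) := by
  intro y₀
  have hK : IsOpen (Metric.ball (0 : ℂ) (‖y₀‖ + 1)) := Metric.isOpen_ball
  have hu : Summable fun j : ℕ => (‖y₀‖ + 1) * ‖p‖ ^ j :=
    (summable_geometric_of_lt_one (norm_nonneg p) hp).mul_left _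
  have h := Summable.hasProdLocallyUniformlyOn_nat_one_add
    (f := fun (j : ℕ) (y : ℂ) => -(y * p ^ j)) hK hu
    (.of_forall fun j y hy => by
      rw [norm_neg, norm_mul, norm_pow]
      have : ‖y‖ < ‖y₀‖ + 1 := by simpa using hy
      gcongr) (fun j => by fun_prop)
  have hd := h.differentiableOn (.of_forall fun s => by
    simpa [Finset.prod_fn] using DifferentiableOn.finsetProd (fun _ _ ↦ by fun_prop)) hK
  have := hd.differentiableAt (hK.mem_nhds (show y₀ ∈ Metric.ball (0 : ℂ) (‖y₀‖ + 1) by simp))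
  have h1 : qPochhammer p = fun y => ∏' j : ℕ, (1 + -(y * p ^ j)) := by
    funext y
    simp only [qPochhammer, sub_eq_add_neg]
  rw [h1]
  exact this

theorem tprod_div_eq_qPochhammer_div {p a b : ℂ} (hp : ‖p‖ < 1) (hb : ∀ j : ℕ, b * p ^ j ≠ 1) :
    ∏' j : ℕ, (1 - a * p ^ j) / (1 - b * p ^ j) = qPochhammer p a / qPochhammer p b :=
  ((hasProd_qPochhammer hp a).div₀ (hasProd_qPochhammer hp b) (qPochhammer_ne_zero hp hb)).tprod_eq

/-- The double series `∑ (y p^j)^m / m` is summed in both orders: over `j` it is geometric, over `m`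
it is `-log (1 - y p^j)`. Recording only `exp (-L)` avoids choosing a logarithm of the infinite
product. -/
theorem exists_hasSum_exp_neg_eq_qPochhammer {p y : ℂ} (hp : ‖p‖ < 1) (hy : ‖y‖ < 1) :
    ∃ L, HasSum (fun m : ℕ => y ^ m / m / (1 - p ^ m)) L ∧
      Complex.exp (-L) = qPochhammer p y := by
  set f : ℕ × ℕ → ℂ := fun x => (y * p ^ x.2) ^ x.1 / x.1 with hf
  have hsum : Summable f := by
    have h1 : Summable fun x : ℕ × ℕ => ‖y‖ ^ x.1 * ‖p‖ ^ x.2 :=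
      Summable.mul_of_nonneg (f := fun m : ℕ => ‖y‖ ^ m) (g := fun j : ℕ => ‖p‖ ^ j)
        (summable_geometric_of_lt_one (norm_nonneg y) hy)
        (summable_geometric_of_lt_one (norm_nonneg p) hp)
        (fun m => pow_nonneg (norm_nonneg _) m) (fun m => pow_nonneg (norm_nonneg _) m)
    refine h1.of_norm_bounded fun ⟨m, j⟩ => ?_
    -- The terms with `m = 0` vanish because division by zero gives zero.
    rcases Nat.eq_zero_or_pos m with rfl | hm
    · simp only [hf, Nat.cast_zero, div_zero, norm_zero]
      positivity
    · simp only [hf, norm_div, norm_pow, norm_mul, Complex.norm_natCast, mul_pow, ← pow_mul]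
      have h2 : (1 : ℝ) ≤ m := by exact_mod_cast hm
      refine (div_le_self (by positivity) h2).trans ?_
      gcongr ?_ * ?_
      exact pow_le_pow_of_le_one (norm_nonneg p) hp.le (Nat.le_mul_of_pos_right j hm)
  have hL := hsum.hasSum
  refine ⟨∑' x, f x, hL.prod_fiberwise fun m => ?_, ?_⟩
  · rcases Nat.eq_zero_or_pos m with rfl | hm
    · simp [hf]
    · have h1 : ‖p ^ m‖ < 1 := by
        rw [norm_pow]; exact pow_lt_one₀ (norm_nonneg p) hp hm.ne'
      have h2 := (hasSum_geometric_of_norm_lt_one h1).mul_left (y ^ m / m)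
      rw [← div_eq_mul_inv] at h2
      have h3 : (fun j => f (m, j)) = fun j => y ^ m / m * (p ^ m) ^ j := by
        funext j
        simp only [hf, mul_pow, ← pow_mul, mul_comm j m]
        ring
      rw [h3]
      exact h2
  · have hL' : HasSum (f ∘ Prod.swap) (∑' x, f x) :=
      (Equiv.hasSum_iff (f := f) (Equiv.prodComm ℕ ℕ)).mpr hL
    have h1 : ∀ j : ℕ, ‖y * p ^ j‖ < 1 := by
      intro j
      rw [norm_mul, norm_pow]
      exact mul_lt_one_of_nonneg_of_lt_one_left (norm_nonneg _) hy
        (pow_le_one₀ (norm_nonneg p) hp.le)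
    have h2 : HasSum (fun j : ℕ => -Complex.log (1 - y * p ^ j)) (∑' x, f x) := by
      refine HasSum.prod_fiberwise hL' fun j => ?_
      simp only [Function.comp_apply, Prod.swap_prod_mk, hf]
      exact Complex.hasSum_taylorSeries_neg_log (h1 j)
    have h3 := h2.neg.cexp
    refine h3.unique ?_
    convert hasProd_qPochhammer hp y using 2 with j
    simp only [Function.comp_apply, neg_neg]
    rw [Complex.exp_log]
    intro h0
    have := h1 j
    rw [show y * p ^ j = 1 by linear_combination -h0] at this
    simp at this

/-! ### Mode coefficients and elementary contractions -/

section Coefficients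

variable (τ k u : ℂ) (m : ℕ+)

theorem pnat_cast_pos : (0 : ℤ) < ((m : ℕ) : ℤ) := by exact_mod_cast m.pos

theorem yPlus_creationCoeff : (yPlus τ k u).creationCoeff (.alphaBar, m) =
    qPow τ (-(k * m / 2)) * Complex.exp (m * u) / qNum τ (k * m) := by
  have h := pnat_cast_pos m
  simp [LinForm.creationCoeff, yPlus, LinForm.ofBoson]

theorem yMinus_annihilationShift : (yMinus τ k u).annihilationShift τ k (.alphaBar, m) =
    qPow τ (k * m / 2) * Complex.exp (-(m * u)) / qNum τ (k * m) *
      (-(qNum τ (2 * m) * qNum τ (k * m) / m)) := by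
  have h := pnat_cast_pos m
  simp [LinForm.annihilationShift, yMinus, LinForm.ofBoson, heisenberg]

theorem plusModes_pos : plusModes τ u ((m : ℕ) : ℤ) =
    -((qPow τ 1 - qPow τ (-1)) * Complex.exp (-(m * u)) * (qNum τ m / qNum τ (2 * m))) := by
  simp [plusModes]

theorem plusModes_neg : plusModes τ u (-((m : ℕ) : ℤ)) = 0 := by
  simp [plusModes]

theorem minusModes_pos : minusModes τ u ((m : ℕ) : ℤ) = 0 := by
  simp [minusModes]

theorem minusModes_neg : minusModes τ u (-((m : ℕ) : ℤ)) =
    (qPow τ 1 - qPow τ (-1)) * Complex.exp (m * u) * (qNum τ m / qNum τ (2 * m)) := by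
  simp [minusModes]

end Coefficients

theorem norm_exp_lt_one {a : ℂ} (h : a.re < 0) : ‖Complex.exp a‖ < 1 := by
  rw [Complex.norm_exp]
  rw [← Real.exp_zero]
  exact Real.exp_lt_exp.mpr h

theorem exp_ne_one_of_re_neg {a : ℂ} (h : a.re < 0) : Complex.exp a ≠ 1 := by
  intro h1
  have := norm_exp_lt_one h
  rw [h1] at this
  simp at this

theorem exp_ne_one_of_re_pos {a : ℂ} (h : 0 < a.re) : Complex.exp a ≠ 1 := by
  intro h1
  refine exp_ne_one_of_re_neg (a := -a) (by simpa using h) ?_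
  rw [Complex.exp_neg, h1, inv_one]

theorem exp_sub_exp_neg_ne_zero {a : ℂ} (h : a.re < 0) : Complex.exp a - Complex.exp (-a) ≠ 0 := by
  intro h1
  refine exp_ne_one_of_re_neg (a := a + a) (by simp; linarith) ?_
  have h2 : Complex.exp a = Complex.exp (-a) := sub_eq_zero.mp h1
  rw [Complex.exp_add]
  nth_rewrite 1 [h2]
  rw [← Complex.exp_add]
  simp

theorem qNum_eq (τ x : ℂ) : qNum τ x =
    (Complex.exp (x * τ) - Complex.exp (-(x * τ))) / (qPow τ 1 - qPow τ (-1)) := by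
  rw [qNum, qPow, qPow, neg_mul]

theorem qPow_sub_ne_zero {τ : ℂ} (hq : τ.re < 0) : qPow τ 1 - qPow τ (-1) ≠ 0 := by
  have := exp_sub_exp_neg_ne_zero hq
  simpa [qPow] using this

theorem qNum_ne_zero {τ x : ℂ} (hq : τ.re < 0) (hx : (x * τ).re < 0) : qNum τ x ≠ 0 := by
  rw [qNum_eq]
  exact div_ne_zero (exp_sub_exp_neg_ne_zero hx) (qPow_sub_ne_zero hq)

theorem re_mul_pnat_neg {a τ : ℂ} (h : (a * τ).re < 0) (m : ℕ+) : (a * m * τ).re < 0 := by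
  rw [mul_right_comm]
  have h1 : (a * τ * (m : ℂ)).re = (a * τ).re * m := by
    rw [← Complex.ofReal_natCast, Complex.re_mul_ofReal]
  rw [h1]
  exact mul_neg_of_neg_of_pos h (by exact_mod_cast m.pos)

/-- The term `y ^ m / m` of the logarithmic series at `y = q ^ a z / w`, where `z = exp u` and
`w = exp ζ`. -/
def logTerm (τ u ζ a : ℂ) (m : ℕ+) : ℂ := Complex.exp (u - ζ + a * τ) ^ (m : ℕ) / m

section Contractions

variable {τ k : ℂ} (ζ u : ℂ) (m : ℕ+)

theorem logTerm_eq (τ u ζ a : ℂ) (m : ℕ+) : logTerm τ u ζ a m =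
    Complex.exp (m * u) * Complex.exp (-(m * ζ)) * Complex.exp (a * m * τ) / m := by
  rw [logTerm, ← Complex.exp_nat_mul, ← Complex.exp_add, ← Complex.exp_add]
  congr 2
  ring

/-- The two factors `1/[km]` against one `[km]` in the commutator leave `-[2m]/[km]`. Writing
`-1/(q^{km} - q^{-km})` as `q^{km}/(1 - q^{2km})` gives the form whose sum is a ratio of Pochhammer
symbols. -/
theorem yMinus_yPlus_contraction (hq : τ.re < 0) (hk : (k * τ).re < 0) :
    (yMinus τ k ζ).annihilationShift τ k (.alphaBar, m) *
      (yPlus τ k u).creationCoeff (.alphaBar, m) =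
    (logTerm τ u ζ (k + 2) m - logTerm τ u ζ (k - 2) m) /
      (1 - Complex.exp (2 * k * τ) ^ (m : ℕ)) := by
  have hN : qNum τ (k * m) ≠ 0 := qNum_ne_zero hq (re_mul_pnat_neg hk m)
  have hD := qPow_sub_ne_zero hq
  have hK : Complex.exp (2 * k * τ) ^ (m : ℕ) = Complex.exp (k * m * τ) ^ 2 := by
    rw [← Complex.exp_nat_mul, ← Complex.exp_nat_mul]
    congr 1
    push_cast
    ring
  have hK1 : Complex.exp (k * m * τ) ^ 2 ≠ 1 := by
    rw [← Complex.exp_nat_mul]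
    refine exp_ne_one_of_re_neg ?_
    have := re_mul_pnat_neg hk m
    simp only [Nat.cast_ofNat, Complex.mul_re, Complex.re_ofNat, Complex.im_ofNat] at this ⊢
    linarith
  have hN2 : qNum τ (k * m) = (Complex.exp (k * m * τ) - (Complex.exp (k * m * τ))⁻¹) /
      (qPow τ 1 - qPow τ (-1)) := by rw [qNum_eq, Complex.exp_neg]
  have h2 : qNum τ (2 * m) = (Complex.exp (m * τ) ^ 2 - (Complex.exp (m * τ) ^ 2)⁻¹) /
      (qPow τ 1 - qPow τ (-1)) := by
    rw [qNum_eq, Complex.exp_neg, ← Complex.exp_nat_mul]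
    simp only [Nat.cast_ofNat, mul_assoc]
  have hc : qPow τ (k * m / 2) * qPow τ (-(k * m / 2)) = 1 := by
    rw [qPow, qPow, ← Complex.exp_add]; ring_nf; simp
  have hp : Complex.exp ((k + 2) * m * τ) = Complex.exp (k * m * τ) * Complex.exp (m * τ) ^ 2 := by
    rw [← Complex.exp_nat_mul, ← Complex.exp_add]; congr 1; push_cast; ring
  have hm : Complex.exp ((k - 2) * m * τ) =
      Complex.exp (k * m * τ) * (Complex.exp (m * τ) ^ 2)⁻¹ := by
    rw [← Complex.exp_nat_mul, ← Complex.exp_neg, ← Complex.exp_add]; congr 1; push_cast; ring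
  have hm0 : ((m : ℕ) : ℂ) ≠ 0 := by exact_mod_cast m.ne_zero
  rw [yMinus_annihilationShift, yPlus_creationCoeff, logTerm_eq, logTerm_eq, hp, hm, hK]
  have hQ := Complex.exp_ne_zero (m * τ)
  have hH := Complex.exp_ne_zero (k * m * τ)
  generalize Complex.exp (k * m * τ) = K at *
  generalize Complex.exp (m * τ) = Q at *
  have hK3 : 1 - K ^ 2 ≠ 0 := sub_ne_zero.mpr hK1.symm
  have hK4 : K - K⁻¹ ≠ 0 := by
    intro h; apply hN; rw [hN2, h, zero_div]
  calc _ = -(Complex.exp (m * u) * Complex.exp (-(m * ζ)) * (qNum τ (2 * m) / qNum τ (k * m)) / m) *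
        (qPow τ (k * m / 2) * qPow τ (-(k * m / 2))) := by
        field_simp
    _ = _ := by
      rw [hc, h2, hN2, div_div_div_cancel_right₀ hD]
      have hK5 : K - K⁻¹ = -((1 - K ^ 2) / K) := by field_simp; ring
      rw [hK5]
      field_simp

theorem zPlus_annihilationShift (s : ℂ) : (zPlus τ s).annihilationShift τ k (.alphaBar, m) =
    plusModes τ s (m : ℕ) * (-(qNum τ (2 * m) * qNum τ (k * m) / m)) := rfl

theorem wPlus_annihilationShift (s : ℂ) : (wPlus τ s).annihilationShift τ k (.beta, m) =
    plusModes τ s (m : ℕ) * (qNum τ (2 * m) * qNum τ ((k + 2) * m) / m) := rfl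

theorem zMinus_creationCoeff (s : ℂ) : (zMinus τ s).creationCoeff (.alphaBar, m) =
    minusModes τ s (-((m : ℕ) : ℤ)) := rfl

theorem wMinus_creationCoeff (s : ℂ) : (wMinus τ s).creationCoeff (.beta, m) =
    minusModes τ s (-((m : ℕ) : ℤ)) := rfl

theorem qNum_pnat (hq : τ.re < 0) (a : ℂ) : qNum τ (a * m) * (qPow τ 1 - qPow τ (-1)) =
    Complex.exp (a * m * τ) - (Complex.exp (a * m * τ))⁻¹ := by
  rw [qNum_eq, Complex.exp_neg, div_mul_cancel₀ _ (qPow_sub_ne_zero hq)]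

theorem exp_add_two_mul (a : ℂ) : Complex.exp ((a + 2) * m * τ) =
    Complex.exp (a * m * τ) * Complex.exp (m * τ) ^ 2 := by
  rw [← Complex.exp_nat_mul, ← Complex.exp_add]
  congr 1
  push_cast
  ring

theorem exp_neg_mul_inv (a : ℂ) : Complex.exp (-a * m * τ) = (Complex.exp (a * m * τ))⁻¹ := by
  rw [← Complex.exp_neg]
  congr 1
  ring

theorem exp_two_mul_sq : Complex.exp (2 * m * τ) = Complex.exp (m * τ) ^ 2 := by
  rw [← Complex.exp_nat_mul]
  congr 1
  push_cast
  ring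

theorem two_mul_re_neg (hq : τ.re < 0) : (2 * τ).re < 0 := by
  simp only [Complex.mul_re, Complex.re_ofNat, Complex.im_ofNat]
  linarith

/-- Here `[2m]` and `[km]` cancel completely. Only `q^m - q^{-m}` remains, that is, two logarithmic
series and hence a ratio of two linear factors in `z / w`. -/
theorem zPlus_yPlus_contraction (hq : τ.re < 0) (hk : (k * τ).re < 0) :
    (zPlus τ (ζ + (k + 2) / 2 * τ)).annihilationShift τ k (.alphaBar, m) *
      (yPlus τ k u).creationCoeff (.alphaBar, m) =
    logTerm τ u ζ (-k) m - logTerm τ u ζ (-(k + 2)) m := by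
  have hN : qNum τ (k * m) ≠ 0 := qNum_ne_zero hq (re_mul_pnat_neg hk m)
  have hN2 : qNum τ (2 * m) ≠ 0 := qNum_ne_zero hq (re_mul_pnat_neg (two_mul_re_neg hq) m)
  have h1 := qNum_pnat m hq 1
  have hm0 : ((m : ℕ) : ℂ) ≠ 0 := by exact_mod_cast m.ne_zero
  have hc : Complex.exp (-(m * (ζ + (k + 2) / 2 * τ))) * qPow τ (-(k * m / 2)) =
      Complex.exp (-(m * ζ)) * (Complex.exp (k * m * τ))⁻¹ * (Complex.exp (m * τ))⁻¹ := by
    rw [qPow, ← Complex.exp_neg, ← Complex.exp_neg, ← Complex.exp_add, ← Complex.exp_add,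
      ← Complex.exp_add]
    congr 1
    ring
  rw [zPlus_annihilationShift, plusModes_pos, yPlus_creationCoeff, logTerm_eq, logTerm_eq,
    exp_neg_mul_inv, exp_neg_mul_inv, exp_add_two_mul]
  simp only [one_mul] at h1
  have hQ := Complex.exp_ne_zero (m * τ)
  have hH := Complex.exp_ne_zero (k * m * τ)
  calc _ = qNum τ m * (qPow τ 1 - qPow τ (-1)) * Complex.exp (m * u) *
        (Complex.exp (-(m * (ζ + (k + 2) / 2 * τ))) * qPow τ (-(k * m / 2))) / m := by
        generalize qNum τ (2 * m) = N₂ at *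
        generalize qNum τ (k * m) = N at *
        field_simp
    _ = _ := by
      rw [hc, h1]
      generalize Complex.exp (k * m * τ) = K at *
      generalize Complex.exp (m * τ) = Q at *
      field_simp

theorem yMinus_zMinus_contraction (hq : τ.re < 0) (hk : (k * τ).re < 0) :
    (yMinus τ k ζ).annihilationShift τ k (.alphaBar, m) *
      (zMinus τ (u + (k + 2) / 2 * τ)).creationCoeff (.alphaBar, m) =
    logTerm τ u ζ k m - logTerm τ u ζ (k + 2) m := by
  have hN : qNum τ (k * m) ≠ 0 := qNum_ne_zero hq (re_mul_pnat_neg hk m)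
  have hN2 : qNum τ (2 * m) ≠ 0 := qNum_ne_zero hq (re_mul_pnat_neg (two_mul_re_neg hq) m)
  have h1 := qNum_pnat m hq 1
  have hm0 : ((m : ℕ) : ℂ) ≠ 0 := by exact_mod_cast m.ne_zero
  have hc : Complex.exp (m * (u + (k + 2) / 2 * τ)) * qPow τ (k * m / 2) =
      Complex.exp (m * u) * Complex.exp (k * m * τ) * Complex.exp (m * τ) := by
    rw [qPow, ← Complex.exp_add, ← Complex.exp_add, ← Complex.exp_add]
    congr 1
    ring
  rw [zMinus_creationCoeff, minusModes_neg, yMinus_annihilationShift, logTerm_eq, logTerm_eq,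
    exp_add_two_mul]
  simp only [one_mul] at h1
  have hQ := Complex.exp_ne_zero (m * τ)
  have hH := Complex.exp_ne_zero (k * m * τ)
  calc _ = -(qNum τ m * (qPow τ 1 - qPow τ (-1)) * Complex.exp (-(m * ζ)) *
        (Complex.exp (m * (u + (k + 2) / 2 * τ)) * qPow τ (k * m / 2)) / m) := by
        generalize qNum τ (2 * m) = N₂ at *
        generalize qNum τ (k * m) = N at *
        field_simp
    _ = _ := by
      rw [hc, h1]
      generalize Complex.exp (k * m * τ) = K at *
      generalize Complex.exp (m * τ) = Q at *
      field_simp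
      ring

/-- The number `(q ^ m - q ^ (-m)) / (q ^ m + q ^ (-m))`. -/
def qTanh (τ : ℂ) (m : ℕ+) : ℂ := (Complex.exp (m * τ) ^ 2 - 1) / (Complex.exp (m * τ) ^ 2 + 1)

theorem norm_exp_sq_le (hq : τ.re < 0) :
    ‖Complex.exp (m * τ) ^ 2‖ ≤ ‖Complex.exp τ‖ := by
  rw [Complex.exp_nat_mul, ← pow_mul, norm_pow]
  exact pow_le_of_le_one (norm_nonneg _) (norm_exp_lt_one hq).le (by positivity)

theorem exp_sq_add_one_ne_zero (hq : τ.re < 0) : Complex.exp (m * τ) ^ 2 + 1 ≠ 0 := by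
  intro h
  have h1 := (norm_exp_sq_le m hq).trans_lt (norm_exp_lt_one hq)
  rw [eq_neg_of_add_eq_zero_left h] at h1
  simp at h1

/-- Uniformity in `m` is what matters: it makes the `Z₊Z₋` and `W₊W₋` series absolutely convergent
separately. -/
theorem norm_qTanh_le (hq : τ.re < 0) : ‖qTanh τ m‖ ≤ 2 / (1 - ‖Complex.exp τ‖) := by
  have h1 := norm_exp_sq_le m hq
  have h2 := norm_exp_lt_one hq
  rw [qTanh, norm_div]
  refine div_le_div₀ (by norm_num) ?_ (by linarith) ?_
  · refine (norm_sub_le _ _).trans ?_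
    rw [norm_one]
    linarith
  · have h3 := norm_sub_le (Complex.exp (m * τ) ^ 2 + 1) (Complex.exp (m * τ) ^ 2)
    rw [add_sub_cancel_left, norm_one] at h3
    linarith

/-- Follows from `[2m] = [m] (q^m + q^{-m})`. -/
theorem qNum_sq_div_qNum (hq : τ.re < 0) (a : ℂ) :
    (qPow τ 1 - qPow τ (-1)) ^ 2 * qNum τ m ^ 2 / qNum τ (2 * m) * qNum τ (a * m) =
      qTanh τ m * (Complex.exp (a * m * τ) - Complex.exp (-a * m * τ)) := by
  have hD := qPow_sub_ne_zero hq
  have hN2 : qNum τ (2 * m) ≠ 0 := qNum_ne_zero hq (re_mul_pnat_neg (two_mul_re_neg hq) m)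
  have h1 := qNum_pnat m hq 1
  have h2 := qNum_pnat m hq 2
  have ha := qNum_pnat m hq a
  have hQ := Complex.exp_ne_zero (m * τ)
  have hQ1 := exp_sq_add_one_ne_zero m hq
  rw [one_mul] at h1
  rw [exp_two_mul_sq] at h2
  have h3 : qNum τ (2 * m) * (qPow τ 1 - qPow τ (-1)) ≠ 0 := mul_ne_zero hN2 hD
  rw [exp_neg_mul_inv, ← ha, qTanh]
  have h4 : qNum τ m * (qPow τ 1 - qPow τ (-1)) * (qNum τ m * (qPow τ 1 - qPow τ (-1))) /
      (qNum τ (2 * m) * (qPow τ 1 - qPow τ (-1))) =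
      (Complex.exp (m * τ) ^ 2 - 1) / (Complex.exp (m * τ) ^ 2 + 1) := by
    rw [h2] at h3 ⊢
    rw [h1, div_eq_div_iff h3 hQ1]
    field_simp
    ring
  rw [← h4]
  field_simp

theorem zPlus_zMinus_contraction (hq : τ.re < 0) :
    (zPlus τ (ζ + (k + 2) / 2 * τ)).annihilationShift τ k (.alphaBar, m) *
      (zMinus τ (u + (k + 2) / 2 * τ)).creationCoeff (.alphaBar, m) =
    qTanh τ m * (logTerm τ u ζ k m - logTerm τ u ζ (-k) m) := by
  have hN2 : qNum τ (2 * m) ≠ 0 := qNum_ne_zero hq (re_mul_pnat_neg (two_mul_re_neg hq) m)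
  have hc : Complex.exp (m * (u + (k + 2) / 2 * τ)) *
      Complex.exp (-(m * (ζ + (k + 2) / 2 * τ))) =
      Complex.exp (m * u) * Complex.exp (-(m * ζ)) := by
    rw [← Complex.exp_add, ← Complex.exp_add]
    congr 1
    ring
  rw [zMinus_creationCoeff, minusModes_neg, zPlus_annihilationShift, plusModes_pos, logTerm_eq,
    logTerm_eq]
  calc _ = (qPow τ 1 - qPow τ (-1)) ^ 2 * qNum τ m ^ 2 / qNum τ (2 * m) * qNum τ (k * m) *
        (Complex.exp (m * (u + (k + 2) / 2 * τ)) *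
        Complex.exp (-(m * (ζ + (k + 2) / 2 * τ)))) / m := by
        field_simp
    _ = _ := by
      rw [hc, qNum_sq_div_qNum m hq]
      ring

theorem wPlus_wMinus_contraction (hq : τ.re < 0) :
    (wPlus τ (ζ + k / 2 * τ)).annihilationShift τ k (.beta, m) *
      (wMinus τ (u + k / 2 * τ)).creationCoeff (.beta, m) =
    -(qTanh τ m * (logTerm τ u ζ (k + 2) m - logTerm τ u ζ (-(k + 2)) m)) := by
  have hN2 : qNum τ (2 * m) ≠ 0 := qNum_ne_zero hq (re_mul_pnat_neg (two_mul_re_neg hq) m)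
  have hc : Complex.exp (m * (u + k / 2 * τ)) * Complex.exp (-(m * (ζ + k / 2 * τ))) =
      Complex.exp (m * u) * Complex.exp (-(m * ζ)) := by
    rw [← Complex.exp_add, ← Complex.exp_add]
    congr 1
    ring
  rw [wMinus_creationCoeff, minusModes_neg, wPlus_annihilationShift, plusModes_pos, logTerm_eq,
    logTerm_eq]
  calc _ = -((qPow τ 1 - qPow τ (-1)) ^ 2 * qNum τ m ^ 2 / qNum τ (2 * m) *
        qNum τ ((k + 2) * m) * (Complex.exp (m * (u + k / 2 * τ)) *
        Complex.exp (-(m * (ζ + k / 2 * τ)))) / m) := by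
        field_simp
    _ = _ := by
      rw [hc, qNum_sq_div_qNum m hq]
      ring

/-- The decisive cancellation. With `K = q^{km}` and `Q = q^m`, the two differences add up to a
multiple of `(Q² + 1)(K - K⁻¹ Q⁻²)`, which clears the denominator of `qTanh`. The levels `k` of `ᾱ`
and `k + 2` of `β`, with opposite commutator signs, make this possible. -/
theorem qTanh_mul_logTerm (hq : τ.re < 0) :
    qTanh τ m * (logTerm τ u ζ k m - logTerm τ u ζ (-k) m) +
      qTanh τ m * (logTerm τ u ζ (k + 2) m - logTerm τ u ζ (-(k + 2)) m) =
    logTerm τ u ζ (k + 2) m + logTerm τ u ζ (-(k + 2)) m - logTerm τ u ζ k m -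
      logTerm τ u ζ (-k) m := by
  have hQ1 := exp_sq_add_one_ne_zero m hq
  have hm0 : ((m : ℕ) : ℂ) ≠ 0 := by exact_mod_cast m.ne_zero
  simp only [logTerm_eq, exp_neg_mul_inv, exp_add_two_mul, qTanh]
  have hQ := Complex.exp_ne_zero (m * τ)
  have hH := Complex.exp_ne_zero (k * m * τ)
  generalize Complex.exp (k * m * τ) = K at *
  generalize Complex.exp (m * τ) = Q at *
  field_simp
  ring

end Contractions

/-! ### Summing contractions over all modes -/

theorem summable_norm_mode {F : Mode → ℂ} (h0 : ∀ m, F (.alpha, m) = 0)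
    (h1 : Summable fun m => F (.alphaBar, m)) (h2 : Summable fun m => F (.beta, m)) :
    (Summable fun i => ‖F i‖) ∧ ∑' i, F i = ∑' m, (F (.alphaBar, m) + F (.beta, m)) := by
  classical
  let _ : Fintype Boson := ⟨{.alpha, .alphaBar, .beta}, by intro x; cases x <;> simp⟩
  have hb : ∀ b : Boson, Summable fun m => F (b, m) := by
    intro b
    cases b with
    | alpha => simpa only [h0] using summable_zero
    | alphaBar => exact h1
    | beta => exact h2
  have hs : Summable fun i => ‖F i‖ :=
    (summable_prod_of_nonneg fun _ => norm_nonneg _).mpr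
      ⟨fun b => (hb b).norm, Summable.of_finite⟩
  refine ⟨hs, ?_⟩
  rw [hs.of_norm.tsum_prod, tsum_fintype, h1.tsum_add h2]
  have : (Finset.univ : Finset Boson) = {.alpha, .alphaBar, .beta} := rfl
  rw [this, Finset.sum_insert (by simp), Finset.sum_insert (by simp), Finset.sum_singleton]
  simp [h0]

theorem hasSum_pnat {f : ℕ → ℂ} {L : ℂ} (h : HasSum f L) (h0 : f 0 = 0) :
    HasSum (fun m : ℕ+ => f m) L := by
  refine (PNat.coe_injective.hasSum_iff fun n hn => ?_).mpr h
  rcases Nat.eq_zero_or_pos n with rfl | hpos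
  · exact h0
  · exact absurd ⟨⟨n, hpos⟩, rfl⟩ hn

/-- The number `q ^ a z / w`, where `z = exp u` and `w = exp ζ`. -/
def pointRatio (τ u a ζ : ℂ) : ℂ := Complex.exp (u - ζ + a * τ)

theorem hasSum_logTerm {τ u a ζ : ℂ} (h : ‖pointRatio τ u a ζ‖ < 1) :
    HasSum (logTerm τ u ζ a) (-Complex.log (1 - pointRatio τ u a ζ)) :=
  hasSum_pnat (Complex.hasSum_taylorSeries_neg_log h) (by simp)

theorem one_sub_ne_zero_of_norm_lt_one {y : ℂ} (h : ‖y‖ < 1) : 1 - y ≠ 0 := by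
  intro h0
  rw [← sub_eq_zero.mp h0] at h
  simp at h

theorem re_two_mul_neg {k τ : ℂ} (hk : (k * τ).re < 0) : (2 * k * τ).re < 0 := by
  rw [mul_assoc]
  simp only [Complex.mul_re (2 : ℂ), Complex.re_ofNat, Complex.im_ofNat]
  linarith

theorem exists_hasSum_logTerm_div {τ k u ζ : ℂ} (hk : (k * τ).re < 0)
    (h₁ : ‖pointRatio τ u (k + 2) ζ‖ < 1) (h₂ : ‖pointRatio τ u (k - 2) ζ‖ < 1) :
    ∃ L, HasSum (fun m => (logTerm τ u ζ (k + 2) m - logTerm τ u ζ (k - 2) m) /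
        (1 - Complex.exp (2 * k * τ) ^ (m : ℕ))) L ∧
      Complex.exp L = qPochhammer (Complex.exp (2 * k * τ)) (pointRatio τ u (k - 2) ζ) /
        qPochhammer (Complex.exp (2 * k * τ)) (pointRatio τ u (k + 2) ζ) := by
  have hp := norm_exp_lt_one (re_two_mul_neg hk)
  obtain ⟨L₁, hL₁, hE₁⟩ := exists_hasSum_exp_neg_eq_qPochhammer hp h₁
  obtain ⟨L₂, hL₂, hE₂⟩ := exists_hasSum_exp_neg_eq_qPochhammer hp h₂
  refine ⟨L₁ - L₂, ?_, ?_⟩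
  · have := (hasSum_pnat hL₁ (by simp)).sub (hasSum_pnat hL₂ (by simp))
    simpa only [logTerm, pointRatio, sub_div] using this
  · rw [← hE₁, ← hE₂, ← Complex.exp_sub]
    congr 1
    ring

/-- For `Re ζ` above this bound all contractions converge. -/
def convergenceBound (τ k u : ℂ) : ℝ :=
  u.re + (|((k - 2) * τ).re| + |((k + 2) * τ).re| + |(k * τ).re|)

theorem norm_pointRatio_lt_one {τ k u ζ : ℂ} (h : convergenceBound τ k u < ζ.re) :
    ‖pointRatio τ u (k + 2) ζ‖ < 1 ∧ ‖pointRatio τ u (k - 2) ζ‖ < 1 ∧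
    ‖pointRatio τ u k ζ‖ < 1 ∧ ‖pointRatio τ u (-k) ζ‖ < 1 ∧
    ‖pointRatio τ u (-(k + 2)) ζ‖ < 1 := by
  have h1 := abs_nonneg ((k - 2) * τ).re
  have h2 := abs_nonneg ((k + 2) * τ).re
  have h3 := abs_nonneg (k * τ).re
  have h4 := le_abs_self ((k - 2) * τ).re
  have h5 := le_abs_self ((k + 2) * τ).re
  have h6 := le_abs_self (k * τ).re
  have h7 := neg_le_abs ((k + 2) * τ).re
  have h8 := neg_le_abs (k * τ).re
  rw [convergenceBound] at h
  refine ⟨?_, ?_, ?_, ?_, ?_⟩ <;> refine norm_exp_lt_one ?_ <;>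
    simp only [Complex.add_re, Complex.sub_re, neg_mul, Complex.neg_re] <;> linarith

/-- Separate summability for the two bosons gives the absolute convergence over all modes that the
product formula needs, while the value may be computed after combining them, where cancellations
occur. -/
theorem isCorrelationFunction_of_hasSum {τ k : ℂ} {φ : ℂ → LinForm} {ψ : LinForm} {C : ℂ → ℂ}
    {R : ℝ} (hC : Meromorphic C)
    (h0 : ∀ ζ m, (φ ζ).annihilationShift τ k (.alpha, m) * ψ.creationCoeff (.alpha, m) = 0)
    (h : ∀ ζ : ℂ, R < ζ.re →
      (Summable fun m =>
        (φ ζ).annihilationShift τ k (.alphaBar, m) * ψ.creationCoeff (.alphaBar, m)) ∧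
      (Summable fun m =>
        (φ ζ).annihilationShift τ k (.beta, m) * ψ.creationCoeff (.beta, m)) ∧
      ∃ L, HasSum (fun m =>
        (φ ζ).annihilationShift τ k (.alphaBar, m) * ψ.creationCoeff (.alphaBar, m) +
        (φ ζ).annihilationShift τ k (.beta, m) * ψ.creationCoeff (.beta, m)) L ∧
        Complex.exp L * Complex.exp ((φ ζ).zeroMode ((1 / 2 : ℂ) • ψ.2)) = C ζ) :
    IsCorrelationFunction τ k φ ψ C := by
  refine ⟨hC, R, fun ζ hζ v d t => ?_⟩
  obtain ⟨h1, h2, L, hL, hE⟩ := h ζ hζ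
  obtain ⟨hs, ht⟩ := summable_norm_mode
    (F := fun i => (φ ζ).annihilationShift τ k i * ψ.creationCoeff i) (h0 ζ) h1 h2
  have := hasSum_productTerm_vertexOp hs v d t
  rw [ht, hL.tsum_eq, hE] at this
  exact this

/-! ### Nonzero modes and zero modes of the four current terms -/

section Currents

variable (τ k u ζ : ℂ) (m : ℕ+)

theorem phiMinus₁_shift_alpha : (phiMinus₁ τ k ζ).annihilationShift τ k (.alpha, m) = 0 := by
  simp [LinForm.annihilationShift, phiMinus₁, yMinus, zPlus, wPlus, LinForm.ofBoson]

theorem phiMinus₁_shift_alphaBar : (phiMinus₁ τ k ζ).annihilationShift τ k (.alphaBar, m) =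
    (yMinus τ k ζ).annihilationShift τ k (.alphaBar, m) +
      (zPlus τ (ζ + (k + 2) / 2 * τ)).annihilationShift τ k (.alphaBar, m) := by
  simp [LinForm.annihilationShift, phiMinus₁, wPlus, LinForm.ofBoson, add_mul]

theorem phiMinus₁_shift_beta : (phiMinus₁ τ k ζ).annihilationShift τ k (.beta, m) =
    -(wPlus τ (ζ + k / 2 * τ)).annihilationShift τ k (.beta, m) := by
  simp [LinForm.annihilationShift, phiMinus₁, yMinus, zPlus, LinForm.ofBoson]

theorem phiMinus₂_shift_alpha : (phiMinus₂ τ k ζ).annihilationShift τ k (.alpha, m) = 0 := by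
  simp [LinForm.annihilationShift, phiMinus₂, yMinus, zMinus, wMinus, LinForm.ofBoson]

theorem phiMinus₂_shift_alphaBar : (phiMinus₂ τ k ζ).annihilationShift τ k (.alphaBar, m) =
    (yMinus τ k ζ).annihilationShift τ k (.alphaBar, m) := by
  simp [LinForm.annihilationShift, phiMinus₂, wMinus, zMinus, LinForm.ofBoson, minusModes_pos]

theorem phiMinus₂_shift_beta : (phiMinus₂ τ k ζ).annihilationShift τ k (.beta, m) = 0 := by
  simp [LinForm.annihilationShift, phiMinus₂, yMinus, zMinus, wMinus, LinForm.ofBoson,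
    minusModes_pos]

theorem phiPlus₁_coeff_alphaBar : (phiPlus₁ τ k u).creationCoeff (.alphaBar, m) =
    (yPlus τ k u).creationCoeff (.alphaBar, m) := by
  simp [LinForm.creationCoeff, phiPlus₁, zPlus, wPlus, LinForm.ofBoson, plusModes_neg]

theorem phiPlus₁_coeff_beta : (phiPlus₁ τ k u).creationCoeff (.beta, m) = 0 := by
  simp [LinForm.creationCoeff, phiPlus₁, yPlus, zPlus, wPlus, LinForm.ofBoson, plusModes_neg]

theorem phiPlus₂_coeff_alphaBar : (phiPlus₂ τ k u).creationCoeff (.alphaBar, m) =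
    (yPlus τ k u).creationCoeff (.alphaBar, m) +
      (zMinus τ (u + (k + 2) / 2 * τ)).creationCoeff (.alphaBar, m) := by
  simp [LinForm.creationCoeff, phiPlus₂, wMinus, LinForm.ofBoson]

theorem phiPlus₂_coeff_beta : (phiPlus₂ τ k u).creationCoeff (.beta, m) =
    (wMinus τ (u + k / 2 * τ)).creationCoeff (.beta, m) := by
  simp [LinForm.creationCoeff, phiPlus₂, yPlus, zMinus, LinForm.ofBoson]

/-- The shift `e^{2ᾱ}` in `Ȳ⁺` changes `ᾱ₀` by `-2`; hence `w^{-ᾱ₀/k}` yields `w^{2/k}` and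
`q^{-ᾱ₀/2}` from `Z₊` yields `q`. For the second term of `Φ⁻`, `Z₋` yields `q⁻¹` instead. -/
theorem phiMinus₁_zeroMode_phiPlus₁ :
    (phiMinus₁ τ k ζ).zeroMode ((1 / 2 : ℂ) • (phiPlus₁ τ k u).2) = 2 / k * ζ + τ := by
  simp [LinForm.zeroMode, zeroEigenvalue, phiMinus₁, phiPlus₁, yPlus, yMinus, zPlus, wPlus,
    LinForm.ofBoson, plusModes]
  ring

theorem phiMinus₁_zeroMode_phiPlus₂ :
    (phiMinus₁ τ k ζ).zeroMode ((1 / 2 : ℂ) • (phiPlus₂ τ k u).2) = 2 / k * ζ + τ := by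
  simp [LinForm.zeroMode, zeroEigenvalue, phiMinus₁, phiPlus₂, yPlus, yMinus, zPlus, wPlus,
    zMinus, wMinus, LinForm.ofBoson, plusModes]
  ring

theorem phiMinus₂_zeroMode_phiPlus₁ :
    (phiMinus₂ τ k ζ).zeroMode ((1 / 2 : ℂ) • (phiPlus₁ τ k u).2) = 2 / k * ζ - τ := by
  simp [LinForm.zeroMode, zeroEigenvalue, phiMinus₂, phiPlus₁, yPlus, yMinus, zPlus, wPlus,
    zMinus, wMinus, LinForm.ofBoson, minusModes]
  ring

theorem phiMinus₂_zeroMode_phiPlus₂ :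
    (phiMinus₂ τ k ζ).zeroMode ((1 / 2 : ℂ) • (phiPlus₂ τ k u).2) = 2 / k * ζ - τ := by
  simp [LinForm.zeroMode, zeroEigenvalue, phiMinus₂, phiPlus₂, yPlus, yMinus,
    zMinus, wMinus, LinForm.ofBoson, minusModes]
  ring

end Currents

/-! ### The four correlation functions -/

/-- The factor
`w ^ (2 / k) ∏ (1 - q ^ (2 k j + k - 2) z / w) / (1 - q ^ (2 k (j + 1) + k + 2) z / w)`
common to all correlation functions. -/
def correlationBase (τ k u ζ : ℂ) : ℂ :=
  Complex.exp (2 / k * ζ) *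
    (qPochhammer (Complex.exp (2 * k * τ)) (pointRatio τ u (k - 2) ζ) /
      qPochhammer (Complex.exp (2 * k * τ)) (pointRatio τ u (3 * k + 2) ζ))

/-- The additional factor of the correlation function of the first terms of `Φ⁻(w)` and `Φ⁺(z)`. -/
def correlationFactor (τ k u ζ : ℂ) : ℂ :=
  (1 - pointRatio τ u (-(k + 2)) ζ) / (1 - pointRatio τ u (-k) ζ)

theorem differentiable_pointRatio (τ u a : ℂ) : Differentiable ℂ (pointRatio τ u a) := by
  unfold pointRatio
  fun_prop

theorem differentiable_qPochhammer_pointRatio {τ k : ℂ} (hk : (k * τ).re < 0) (u a : ℂ) :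
    Differentiable ℂ
      fun ζ => qPochhammer (Complex.exp (2 * k * τ)) (pointRatio τ u a ζ) :=
  (differentiable_qPochhammer (norm_exp_lt_one (re_two_mul_neg hk))).comp
    (differentiable_pointRatio τ u a)

theorem Differentiable.meromorphic {f : ℂ → ℂ} (h : Differentiable ℂ f) : Meromorphic f :=
  fun x => (h.analyticAt x).meromorphicAt

theorem meromorphic_correlationBase {τ k : ℂ} (hk : (k * τ).re < 0) (u : ℂ) :
    Meromorphic (correlationBase τ k u) := by
  have h1 : Differentiable ℂ fun ζ : ℂ => Complex.exp (2 / k * ζ) := by fun_prop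
  exact h1.meromorphic.mul ((differentiable_qPochhammer_pointRatio hk u _).meromorphic.div
    (differentiable_qPochhammer_pointRatio hk u _).meromorphic)

theorem meromorphic_one_sub_pointRatio (τ u a : ℂ) :
    Meromorphic fun ζ => 1 - pointRatio τ u a ζ :=
  ((differentiable_pointRatio τ u a).const_sub 1).meromorphic

theorem meromorphic_correlationFactor (τ k u : ℂ) : Meromorphic (correlationFactor τ k u) :=
  (meromorphic_one_sub_pointRatio τ u _).div (meromorphic_one_sub_pointRatio τ u _)

/-- The correlation function of the first terms of `Φ⁻(w)` and `Φ⁺(z)`. -/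
def correlation₁₁ (τ k u ζ : ℂ) : ℂ :=
  (1 - pointRatio τ u (k + 2) ζ)⁻¹ *
    (Complex.exp τ * correlationFactor τ k u ζ * correlationBase τ k u ζ)

/-- The correlation function of the second term of `Φ⁻(w)` and the first term of `Φ⁺(z)`. -/
def correlation₂₁ (τ k u ζ : ℂ) : ℂ :=
  (1 - pointRatio τ u (k + 2) ζ)⁻¹ * (Complex.exp (-τ) * correlationBase τ k u ζ)

/-- The correlation function of the first term of `Φ⁻(w)` and the second term of `Φ⁺(z)`. -/
def correlation₁₂ (τ k u ζ : ℂ) : ℂ :=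
  (1 - pointRatio τ u (k + 2) ζ)⁻¹ * (Complex.exp τ * correlationBase τ k u ζ)

/-- The correlation function of the second terms of `Φ⁻(w)` and `Φ⁺(z)`. -/
def correlation₂₂ (τ k u ζ : ℂ) : ℂ :=
  (1 - pointRatio τ u k ζ)⁻¹ * (Complex.exp (-τ) * correlationBase τ k u ζ)

/-- Isolates the one factor that vanishes at `w = q^{k+2} z`, leaving `correlationBase` regular
there. -/
theorem qPochhammer_pointRatio {τ k : ℂ} (hk : (k * τ).re < 0) (u ζ : ℂ) :
    qPochhammer (Complex.exp (2 * k * τ)) (pointRatio τ u (k + 2) ζ) =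
      (1 - pointRatio τ u (k + 2) ζ) *
        qPochhammer (Complex.exp (2 * k * τ)) (pointRatio τ u (3 * k + 2) ζ) := by
  rw [qPochhammer_eq (norm_exp_lt_one (re_two_mul_neg hk))]
  congr 2
  rw [pointRatio, pointRatio, ← Complex.exp_add]
  congr 1
  ring

variable {τ k : ℂ}

theorem isCorrelationFunction₂₁ (hq : τ.re < 0) (hk : (k * τ).re < 0) (u : ℂ) :
    IsCorrelationFunction τ k (phiMinus₂ τ k) (phiPlus₁ τ k u) (correlation₂₁ τ k u) := by
  refine isCorrelationFunction_of_hasSum (R := convergenceBound τ k u)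
    ((meromorphic_one_sub_pointRatio τ u _).inv.mul
      ((Meromorphic.const _).mul (meromorphic_correlationBase hk u)))
    (fun ζ m => by rw [phiMinus₂_shift_alpha, zero_mul]) fun ζ hζ => ?_
  obtain ⟨h1, h2, -, -, -⟩ := norm_pointRatio_lt_one hζ
  obtain ⟨L, hL, hE⟩ := exists_hasSum_logTerm_div hk h1 h2
  simp only [phiMinus₂_shift_alphaBar, phiMinus₂_shift_beta, phiPlus₁_coeff_alphaBar,
    yMinus_yPlus_contraction _ _ _ hq hk, zero_mul, add_zero]
  refine ⟨hL.summable, summable_zero, L, hL, ?_⟩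
  rw [hE, phiMinus₂_zeroMode_phiPlus₁, correlation₂₁, correlationBase, qPochhammer_pointRatio hk,
    sub_eq_add_neg (2 / k * ζ), Complex.exp_add, div_mul_eq_div_div]
  ring

theorem isCorrelationFunction₁₁ (hq : τ.re < 0) (hk : (k * τ).re < 0) (u : ℂ) :
    IsCorrelationFunction τ k (phiMinus₁ τ k) (phiPlus₁ τ k u) (correlation₁₁ τ k u) := by
  refine isCorrelationFunction_of_hasSum (R := convergenceBound τ k u)
    ((meromorphic_one_sub_pointRatio τ u _).inv.mul
      (((Meromorphic.const _).mul (meromorphic_correlationFactor τ k u)).mul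
        (meromorphic_correlationBase hk u)))
    (fun ζ m => by rw [phiMinus₁_shift_alpha, zero_mul]) fun ζ hζ => ?_
  obtain ⟨h1, h2, -, h4, h5⟩ := norm_pointRatio_lt_one hζ
  obtain ⟨L, hL, hE⟩ := exists_hasSum_logTerm_div hk h1 h2
  simp only [phiMinus₁_shift_alphaBar, phiMinus₁_shift_beta, phiPlus₁_coeff_alphaBar,
    phiPlus₁_coeff_beta, add_mul, zPlus_yPlus_contraction _ _ _ hq hk,
    yMinus_yPlus_contraction _ _ _ hq hk, mul_zero, add_zero]
  have hS := hL.add ((hasSum_logTerm h4).sub (hasSum_logTerm h5))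
  refine ⟨hS.summable, summable_zero, _, hS, ?_⟩
  rw [Complex.exp_add, hE, phiMinus₁_zeroMode_phiPlus₁, correlation₁₁, correlationBase,
    qPochhammer_pointRatio hk, Complex.exp_add, div_mul_eq_div_div, Complex.exp_sub,
    Complex.exp_neg, Complex.exp_neg, Complex.exp_log (one_sub_ne_zero_of_norm_lt_one h4),
    Complex.exp_log (one_sub_ne_zero_of_norm_lt_one h5), correlationFactor,
    div_inv_eq_mul]
  ring

/-- The `Ȳ⁻Z₋` contraction contributes `(1 - q^{k+2} z/w) / (1 - q^k z/w)`; its numerator cancels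
the pole at `w = q^{k+2} z`. -/
theorem isCorrelationFunction₂₂ (hq : τ.re < 0) (hk : (k * τ).re < 0) (u : ℂ) :
    IsCorrelationFunction τ k (phiMinus₂ τ k) (phiPlus₂ τ k u) (correlation₂₂ τ k u) := by
  refine isCorrelationFunction_of_hasSum (R := convergenceBound τ k u)
    ((meromorphic_one_sub_pointRatio τ u _).inv.mul
      ((Meromorphic.const _).mul (meromorphic_correlationBase hk u)))
    (fun ζ m => by rw [phiMinus₂_shift_alpha, zero_mul]) fun ζ hζ => ?_
  obtain ⟨h1, h2, h3, -, -⟩ := norm_pointRatio_lt_one hζ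
  obtain ⟨L, hL, hE⟩ := exists_hasSum_logTerm_div hk h1 h2
  simp only [phiMinus₂_shift_alphaBar, phiMinus₂_shift_beta, phiPlus₂_coeff_alphaBar,
    mul_add, yMinus_zMinus_contraction _ _ _ hq hk,
    yMinus_yPlus_contraction _ _ _ hq hk, zero_mul, add_zero]
  have hS := hL.add ((hasSum_logTerm h3).sub (hasSum_logTerm h1))
  refine ⟨hS.summable, summable_zero, _, hS, ?_⟩
  have h6 := one_sub_ne_zero_of_norm_lt_one h1
  rw [Complex.exp_add, hE, phiMinus₂_zeroMode_phiPlus₂, correlation₂₂, correlationBase,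
    qPochhammer_pointRatio hk, sub_eq_add_neg (2 / k * ζ), Complex.exp_add, div_mul_eq_div_div,
    Complex.exp_sub, Complex.exp_neg, Complex.exp_neg (Complex.log _),
    Complex.exp_log (one_sub_ne_zero_of_norm_lt_one h3), Complex.exp_log h6]
  field_simp

theorem summable_qTanh_mul (hq : τ.re < 0) {f : ℕ+ → ℂ} (hf : Summable f) :
    Summable fun m => qTanh τ m * f m := by
  refine (hf.norm.mul_left (2 / (1 - ‖Complex.exp τ‖))).of_norm_bounded fun m => ?_
  rw [norm_mul]
  gcongr
  exact norm_qTanh_le m hq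

theorem isCorrelationFunction₁₂ (hq : τ.re < 0) (hk : (k * τ).re < 0) (u : ℂ) :
    IsCorrelationFunction τ k (phiMinus₁ τ k) (phiPlus₂ τ k u) (correlation₁₂ τ k u) := by
  refine isCorrelationFunction_of_hasSum (R := convergenceBound τ k u)
    ((meromorphic_one_sub_pointRatio τ u _).inv.mul
      ((Meromorphic.const _).mul (meromorphic_correlationBase hk u)))
    (fun ζ m => by rw [phiMinus₁_shift_alpha, zero_mul]) fun ζ hζ => ?_
  obtain ⟨h1, h2, h3, h4, h5⟩ := norm_pointRatio_lt_one hζ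
  obtain ⟨L, hL, hE⟩ := exists_hasSum_logTerm_div hk h1 h2
  simp only [phiMinus₁_shift_alphaBar, phiMinus₁_shift_beta, phiPlus₂_coeff_alphaBar,
    phiPlus₂_coeff_beta, add_mul, mul_add, zPlus_yPlus_contraction _ _ _ hq hk,
    yMinus_yPlus_contraction _ _ _ hq hk, yMinus_zMinus_contraction _ _ _ hq hk, neg_mul,
    zPlus_zMinus_contraction _ _ _ hq, wPlus_wMinus_contraction _ _ _ hq, neg_neg]
  have hβ := summable_qTanh_mul hq ((hasSum_logTerm h1).sub (hasSum_logTerm h5)).summable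
  have hα := summable_qTanh_mul hq ((hasSum_logTerm h3).sub (hasSum_logTerm h4)).summable
  refine ⟨(hL.summable.add ((hasSum_logTerm h4).sub (hasSum_logTerm h5)).summable).add
    (((hasSum_logTerm h3).sub (hasSum_logTerm h1)).summable.add hα), hβ, L, ?_, ?_⟩
  -- The contractions `Z₊Ȳ⁺`, `Ȳ⁻Z₋`, `Z₊Z₋` and `W₊W₋` add up to zero for every `m`, leaving only
  -- `Ȳ⁻Ȳ⁺`.
  · convert hL using 2 with m
    linear_combination qTanh_mul_logTerm (k := k) ζ u m hq
  · rw [hE, phiMinus₁_zeroMode_phiPlus₂, correlation₁₂, correlationBase,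
      qPochhammer_pointRatio hk, Complex.exp_add, div_mul_eq_div_div]
    ring

/-! ### Matrix elements are entire in the logarithmic coordinate -/

section Analyticity

variable {σ : Type*}

theorem differentiable_coeff_translation {a : ℂ → σ → ℂ}
    (ha : ∀ i, Differentiable ℂ fun ζ => a ζ i) (p : MvPolynomial σ ℂ) (t : σ →₀ ℕ) :
    Differentiable ℂ fun ζ => MvPolynomial.coeff t (translation (a ζ) p) := by
  classical
  induction p using MvPolynomial.induction_on generalizing t with
  | C c =>
    have h1 : ∀ ζ, translation (a ζ) (MvPolynomial.C c) = MvPolynomial.C c := by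
      intro ζ
      rw [← MvPolynomial.algebraMap_eq]
      exact AlgHom.commutes _ _
    simp only [h1]
    exact differentiable_const _
  | add p q hp hq =>
    simp only [map_add, MvPolynomial.coeff_add]
    exact (hp t).add (hq t)
  | mul_X p i hp =>
    have h1 : ∀ ζ, translation (a ζ) (p * MvPolynomial.X i) =
        translation (a ζ) p * MvPolynomial.X i +
          MvPolynomial.C (a ζ i) * translation (a ζ) p := by
      intro ζ
      rw [map_mul]
      simp only [translation, MvPolynomial.aeval_X]
      ring
    simp only [h1, MvPolynomial.coeff_add, MvPolynomial.coeff_C_mul, MvPolynomial.coeff_mul_X']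
    refine Differentiable.add ?_ ((ha i).mul (hp t))
    split_ifs
    · exact hp _
    · exact differentiable_const _

theorem differentiable_coeff_multiExp {a : ℂ → σ → ℂ}
    (ha : ∀ i, Differentiable ℂ fun ζ => a ζ i) (t : σ →₀ ℕ) :
    Differentiable ℂ fun ζ => MvPowerSeries.coeff t (multiExp (a ζ)) := by
  simp only [coeff_multiExp, Finsupp.prod, smul_eq_mul]
  exact Differentiable.fun_finsetProd fun i _ => ((ha i).fun_pow _).const_mul _

end Analyticity

/-- A fixed matrix element involves finitely many modes, hence finite sums and products of entire
functions. Constancy of the charge shift keeps the target label independent of `ζ`. -/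
theorem differentiable_matrixElement_vertexOp {τ k : ℂ} {Φ : ℂ → LinForm} {x : Boson → ℂ}
    (h : ∀ b n, Differentiable ℂ fun ζ => (Φ ζ).1 b n) (hx : ∀ ζ, (Φ ζ).2 = x)
    (v : FockSum) (d : Charge) (t : Mode →₀ ℕ) :
    Differentiable ℂ fun ζ => matrixElement (vertexOp τ k (Φ ζ)) v d t := by
  classical
  induction v using Finsupp.induction_linear with
  | zero =>
    simp only [matrixElement_zero_right]
    exact differentiable_const _
  | add v v' hv hv' =>
    simp only [matrixElement_add_right]
    exact hv.add hv'
  | single c p =>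
    simp only [matrixElement_vertexOp_single, hx]
    split_ifs
    · refine Differentiable.mul (Differentiable.cexp ?_) ?_
      · simp only [LinForm.zeroMode]
        exact (((h _ _).mul_const _).add ((h _ _).mul_const _)).add ((h _ _).mul_const _)
      · simp only [MvPowerSeries.coeff_mul, expCreation_eq_multiExp, MvPolynomial.coeff_coe,
          expAnnihilation_eq_translation]
        refine Differentiable.fun_sum fun s _ => Differentiable.mul ?_ ?_
        · exact differentiable_coeff_multiExp (fun i => h _ _) _
        · exact differentiable_coeff_translation (fun i => (h _ _).mul_const _) _ _
    · exact differentiable_const _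

/-! ### Residue and pole order in the logarithmic coordinate -/

theorem circleIntegral_log_eventually {ζ₀ : ℂ} {G H : ℂ → ℂ} (hG : AnalyticAt ℂ G ζ₀)
    (hH : AnalyticAt ℂ H ζ₀) :
    ∀ᶠ r : ℝ in 𝓝[>] 0,
      (∮ w in C(Complex.exp ζ₀, r),
        ((1 - Complex.exp (ζ₀ - (ζ₀ + Complex.log (w / Complex.exp ζ₀))))⁻¹ *
            G (ζ₀ + Complex.log (w / Complex.exp ζ₀)) +
          H (ζ₀ + Complex.log (w / Complex.exp ζ₀)))) =
        2 * Real.pi * Complex.I * Complex.exp ζ₀ * G ζ₀ := by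
  set w₀ := Complex.exp ζ₀ with hw₀
  have hne : w₀ ≠ 0 := Complex.exp_ne_zero _
  set l : ℂ → ℂ := fun w => ζ₀ + Complex.log (w / w₀) with hl
  have hl0 : l w₀ = ζ₀ := by simp [hl, div_self hne]
  have hla : AnalyticAt ℂ l w₀ := by
    refine analyticAt_const.add ((AnalyticAt.div analyticAt_id analyticAt_const hne).clog ?_)
    simp [div_self hne]
  -- Since `(1 - w₀/w)⁻¹ = w / (w - w₀)`, the integrand is `F w / (w - w₀)` with `F` analytic at
  -- `w₀`, and Cauchy's formula gives `F w₀ = w₀ * G ζ₀`.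
  set F : ℂ → ℂ := fun w => w * G (l w) + (w - w₀) * H (l w) with hF
  have hFa : AnalyticAt ℂ F w₀ :=
    (analyticAt_id.mul (AnalyticAt.fun_comp (by rwa [hl0]) hla)).add
      ((analyticAt_id.sub analyticAt_const).mul (AnalyticAt.fun_comp (by rwa [hl0]) hla))
  obtain ⟨ε, hε, hball⟩ := Metric.eventually_nhds_iff_ball.mp hFa.eventually_analyticAt
  -- The bound `ε` keeps the closed disc where `F` is analytic; the bound `‖w₀‖` keeps the circle
  -- away from `w = 0`.
  have hev : ∀ᶠ r : ℝ in 𝓝[>] 0, r < min ε ‖w₀‖ :=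
    eventually_nhdsWithin_of_eventually_nhds
      (eventually_lt_nhds (lt_min hε (norm_pos_iff.mpr hne)))
  filter_upwards [hev, self_mem_nhdsWithin] with r hr hr0
  have hr0' : (0 : ℝ) < r := hr0
  have hd : DifferentiableOn ℂ F (Metric.closedBall w₀ r) := fun w hw =>
    (hball w (Metric.closedBall_subset_ball (hr.trans_le (min_le_left _ _)) hw)
      ).differentiableAt.differentiableWithinAt
  have hC := hd.circleIntegral_sub_inv_smul (Metric.mem_ball_self hr0')
  have hF0 : F w₀ = w₀ * G ζ₀ := by simp [hF, hl0]
  rw [hF0, smul_eq_mul, ← mul_assoc] at hC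
  rw [← hC]
  refine circleIntegral.integral_congr hr0'.le fun w hw => ?_
  have hw1 : w - w₀ ≠ 0 := by
    rw [← norm_pos_iff, ← dist_eq_norm, Metric.mem_sphere.mp hw]
    exact hr0'
  have hw2 : w ≠ 0 := by
    rintro rfl
    rw [mem_sphere_iff_norm, zero_sub, norm_neg] at hw
    exact absurd (hr.trans_le (min_le_right _ _)) (by rw [hw]; exact lt_irrefl _)
  have h1 : Complex.exp (ζ₀ - l w) = w₀ / w := by
    simp only [hl, sub_add_cancel_left]
    rw [Complex.exp_neg, Complex.exp_log (div_ne_zero hw2 hne), inv_div]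
  have h2 : (1 - w₀ / w)⁻¹ = (w - w₀)⁻¹ * w := by
    rw [one_sub_div hw2, inv_div, div_eq_inv_mul]
  change (1 - Complex.exp (ζ₀ - l w))⁻¹ * G (l w) + H (l w) = (w - w₀)⁻¹ • F w
  rw [h1, h2, hF, smul_eq_mul]
  field_simp

theorem meromorphicOrderAt_inv_one_sub_exp_mul {ζ₀ : ℂ} {G : ℂ → ℂ} (hG : AnalyticAt ℂ G ζ₀)
    (hG0 : G ζ₀ ≠ 0) :
    meromorphicOrderAt (fun ζ => (1 - Complex.exp (ζ₀ - ζ))⁻¹ * G ζ) ζ₀ =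
      ((-1 : ℤ) : WithTop ℤ) := by
  have ha : AnalyticAt ℂ (fun ζ => 1 - Complex.exp (ζ₀ - ζ)) ζ₀ := by fun_prop
  have hd : HasDerivAt (fun ζ => 1 - Complex.exp (ζ₀ - ζ)) 1 ζ₀ := by
    have := (((hasDerivAt_id ζ₀).const_sub ζ₀).cexp).const_sub 1
    simpa using this
  have h1 : analyticOrderAt (fun ζ => 1 - Complex.exp (ζ₀ - ζ)) ζ₀ = 1 := by
    refine ha.analyticOrderAt_eq_one_of_zero_deriv_ne_zero (by simp) ?_
    rw [hd.deriv]
    exact one_ne_zero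
  have h2 : meromorphicOrderAt G ζ₀ = 0 := by
    rw [hG.meromorphicOrderAt_eq, hG.analyticOrderAt_eq_zero.mpr hG0]
    rfl
  have h3 := meromorphicOrderAt_mul (ha.meromorphicAt.inv) hG.meromorphicAt
  rw [meromorphicOrderAt_inv, ha.meromorphicOrderAt_eq, h1, h2, add_zero] at h3
  exact h3

/-! ### Behaviour of the correlation factors at the residue point -/

section Current

variable {τ k : ℂ}

theorem differentiable_plusModes (τ c : ℂ) (n : ℤ) :
    Differentiable ℂ fun ζ => plusModes τ (ζ + c) n := by
  unfold plusModes
  split_ifs <;> fun_prop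

theorem differentiable_minusModes (τ c : ℂ) (n : ℤ) :
    Differentiable ℂ fun ζ => minusModes τ (ζ - c) n := by
  unfold minusModes
  split_ifs <;> fun_prop

theorem differentiable_yMinus (τ k : ℂ) (n : ℤ) :
    Differentiable ℂ fun ζ => (yMinus τ k ζ).1 .alphaBar n := by
  simp only [yMinus, LinForm.ofBoson]
  split_ifs <;> fun_prop

theorem differentiable_phiMinus₁ (τ k : ℂ) (ψ : LinForm) (b : Boson) (n : ℤ) :
    Differentiable ℂ fun ζ => (phiMinus₁ τ k ζ + ψ).1 b n := by
  have h1 := differentiable_yMinus τ k n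
  have h2 := differentiable_plusModes τ ((k + 2) / 2 * τ) n
  have h3 := differentiable_plusModes τ (k / 2 * τ) n
  cases b with
  | alpha => simp [phiMinus₁, yMinus, zPlus, wPlus, LinForm.ofBoson]
  | alphaBar => simpa [phiMinus₁, zPlus, wPlus, LinForm.ofBoson]
      using (h1.add h2).add_const (ψ.1 .alphaBar n)
  | beta => simpa [phiMinus₁, yMinus, zPlus, wPlus, LinForm.ofBoson]
      using h3.neg.add_const (ψ.1 .beta n)

theorem differentiable_phiMinus₂ (τ k : ℂ) (ψ : LinForm) (b : Boson) (n : ℤ) :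
    Differentiable ℂ fun ζ => (phiMinus₂ τ k ζ + ψ).1 b n := by
  have h1 := differentiable_yMinus τ k n
  have h2 := differentiable_minusModes τ ((k + 2) / 2 * τ) n
  have h3 := differentiable_minusModes τ (k / 2 * τ) n
  cases b with
  | alpha => simp [phiMinus₂, yMinus, zMinus, wMinus, LinForm.ofBoson]
  | alphaBar => simpa [phiMinus₂, zMinus, wMinus, LinForm.ofBoson]
      using (h1.add h2).add_const (ψ.1 .alphaBar n)
  | beta => simpa [phiMinus₂, yMinus, zMinus, wMinus, LinForm.ofBoson]
      using h3.neg.add_const (ψ.1 .beta n)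

theorem differentiable_matrixElement_phiMinus₁ (τ k : ℂ) (ψ : LinForm) (v : FockSum) (d : Charge)
    (t : Mode →₀ ℕ) :
    Differentiable ℂ fun ζ => matrixElement (vertexOp τ k (phiMinus₁ τ k ζ + ψ)) v d t :=
  differentiable_matrixElement_vertexOp (x := (phiMinus₁ τ k 0 + ψ).2)
    (differentiable_phiMinus₁ τ k ψ) (fun _ => rfl) v d t

theorem differentiable_matrixElement_phiMinus₂ (τ k : ℂ) (ψ : LinForm) (v : FockSum) (d : Charge)
    (t : Mode →₀ ℕ) :
    Differentiable ℂ fun ζ => matrixElement (vertexOp τ k (phiMinus₂ τ k ζ + ψ)) v d t :=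
  differentiable_matrixElement_vertexOp (x := (phiMinus₂ τ k 0 + ψ).2)
    (differentiable_phiMinus₂ τ k ψ) (fun _ => rfl) v d t

theorem pointRatio_residuePoint (τ u k a : ℂ) :
    pointRatio τ u a (u + (k + 2) * τ) = Complex.exp ((a - (k + 2)) * τ) := by
  rw [pointRatio]
  congr 1
  ring

theorem pointRatio_eq_exp_sub (τ u k ζ : ℂ) :
    pointRatio τ u (k + 2) ζ = Complex.exp (u + (k + 2) * τ - ζ) := by
  rw [pointRatio]
  congr 1
  ring

/-- At this point the denominator factors are `1 - q^{2k(j+1)}`, nonzero because `|q^k| < 1`. -/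
theorem analyticAt_correlationBase (hk : (k * τ).re < 0) (u : ℂ) :
    AnalyticAt ℂ (correlationBase τ k u) (u + (k + 2) * τ) := by
  have h1 : Differentiable ℂ fun ζ : ℂ => Complex.exp (2 / k * ζ) := by fun_prop
  have hk2 := re_two_mul_neg hk
  refine (h1.analyticAt _).mul (((differentiable_qPochhammer_pointRatio hk u _).analyticAt _).div
    ((differentiable_qPochhammer_pointRatio hk u _).analyticAt _) ?_)
  refine qPochhammer_ne_zero (norm_exp_lt_one hk2) fun j => ?_
  rw [pointRatio_residuePoint, show (3 * k + 2 - (k + 2)) * τ = 2 * k * τ by ring, ← pow_succ']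
  intro h
  have h2 := pow_lt_one₀ (norm_nonneg _) (norm_exp_lt_one hk2) (Nat.succ_ne_zero j)
  rw [← norm_pow, h, norm_one] at h2
  exact lt_irrefl _ h2

theorem analyticAt_inv_one_sub_pointRatio (u a ζ : ℂ) (h : pointRatio τ u a ζ ≠ 1) :
    AnalyticAt ℂ (fun ζ => (1 - pointRatio τ u a ζ)⁻¹) ζ :=
  (((differentiable_pointRatio τ u a).const_sub 1).analyticAt ζ).inv (sub_ne_zero.mpr h.symm)

theorem re_natCast_mul_neg {a : ℂ} (h : a.re < 0) (n : ℕ) (hn : 0 < n) : (n * a).re < 0 := by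
  rw [← Complex.ofReal_natCast, Complex.re_ofReal_mul]
  exact mul_neg_of_pos_of_neg (by exact_mod_cast hn) h

theorem pointRatio_residuePoint_ne_one (hq : τ.re < 0) (u : ℂ) :
    pointRatio τ u k (u + (k + 2) * τ) ≠ 1 := by
  rw [pointRatio_residuePoint]
  refine exp_ne_one_of_re_pos ?_
  have h := re_natCast_mul_neg hq 2 two_pos
  rw [show (k - (k + 2)) * τ = -(((2 : ℕ) : ℂ) * τ) by push_cast; ring, Complex.neg_re]
  linarith

theorem pointRatio_neg_residuePoint_ne_one (hq : τ.re < 0) (hk : (k * τ).re < 0) (u : ℂ) :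
    pointRatio τ u (-k) (u + (k + 2) * τ) ≠ 1 ∧
    pointRatio τ u (-(k + 2)) (u + (k + 2) * τ) ≠ 1 := by
  rw [pointRatio_residuePoint, pointRatio_residuePoint]
  have h2 := re_natCast_mul_neg hk 2 two_pos
  constructor <;> refine exp_ne_one_of_re_pos ?_
  · have h := re_natCast_mul_neg hq 2 two_pos
    rw [show (-k - (k + 2)) * τ = -(((2 : ℕ) : ℂ) * τ) + -(((2 : ℕ) : ℂ) * (k * τ)) by
      push_cast; ring, Complex.add_re, Complex.neg_re, Complex.neg_re]
    linarith
  · have h := re_natCast_mul_neg hq 4 four_pos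
    rw [show (-(k + 2) - (k + 2)) * τ = -(((4 : ℕ) : ℂ) * τ) + -(((2 : ℕ) : ℂ) * (k * τ)) by
      push_cast; ring, Complex.add_re, Complex.neg_re, Complex.neg_re]
    linarith

theorem analyticAt_correlationFactor (hq : τ.re < 0) (hk : (k * τ).re < 0) (u : ℂ) :
    AnalyticAt ℂ (correlationFactor τ k u) (u + (k + 2) * τ) :=
  (((differentiable_pointRatio τ u _).const_sub 1).analyticAt _).div
    (((differentiable_pointRatio τ u _).const_sub 1).analyticAt _)
    (sub_ne_zero.mpr (pointRatio_neg_residuePoint_ne_one hq hk u).1.symm)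

theorem correlationFactor_ne_zero (hq : τ.re < 0) (hk : (k * τ).re < 0) (u : ℂ) :
    correlationFactor τ k u (u + (k + 2) * τ) ≠ 0 :=
  div_ne_zero (sub_ne_zero.mpr (pointRatio_neg_residuePoint_ne_one hq hk u).2.symm)
    (sub_ne_zero.mpr (pointRatio_neg_residuePoint_ne_one hq hk u).1.symm)

/-- The factor `1 - q^{-4}` in `rho` is the zeroth numerator factor of `correlationBase`, and
`w₀^{1+2/k}` combines the residue `w₀` with the zero-mode power `w₀^{2/k}`. -/
theorem rho_eq (hk : (k * τ).re < 0) (u : ℂ) :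
    rho τ k u = 2 * Real.pi * Complex.I * Complex.exp (u + (k + 2) * τ) *
      correlationBase τ k u (u + (k + 2) * τ) := by
  have hp := norm_exp_lt_one (re_two_mul_neg hk)
  have hprod : ∏' j : ℕ, (1 - qPow τ (2 * k * (j + 1) - 4)) / (1 - qPow τ (2 * k * (j + 1))) =
      qPochhammer (Complex.exp (2 * k * τ)) (Complex.exp (-4 * τ) * Complex.exp (2 * k * τ)) /
        qPochhammer (Complex.exp (2 * k * τ)) (Complex.exp (2 * k * τ)) := by
    rw [← tprod_div_eq_qPochhammer_div hp]
    · refine tprod_congr fun j => ?_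
      have h1 : Complex.exp (2 * k * (j + 1) * τ) =
          Complex.exp (2 * k * τ) * Complex.exp (2 * k * τ) ^ j := by
        rw [← pow_succ', ← Complex.exp_nat_mul]
        congr 1
        push_cast
        ring
      have h2 : Complex.exp ((2 * k * (j + 1) - 4) * τ) =
          Complex.exp (-4 * τ) * Complex.exp (2 * k * τ) * Complex.exp (2 * k * τ) ^ j := by
        rw [mul_assoc (Complex.exp _), ← h1, ← Complex.exp_add]
        congr 1
        ring
      rw [qPow, qPow, h1, h2]
    · intro j h
      have h2 := pow_lt_one₀ (norm_nonneg _) hp (Nat.succ_ne_zero j)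
      rw [← norm_pow, pow_succ', h, norm_one] at h2
      exact lt_irrefl _ h2
  rw [rho, hprod, correlationBase, pointRatio_residuePoint, pointRatio_residuePoint,
    show (k - 2 - (k + 2)) * τ = -4 * τ by ring,
    show (3 * k + 2 - (k + 2)) * τ = 2 * k * τ by ring,
    qPochhammer_eq hp (Complex.exp (-4 * τ)), qPow, add_mul 1, one_mul, Complex.exp_add]
  ring

/-- The numerator factors are `1 - q^{2kj-4}` with `j ≥ 0`, which is where genericity enters. The
case `j = 0` reads `q^4 ≠ 1` and is automatic when `|q| < 1`. -/
theorem correlationBase_ne_zero (hk : (k * τ).re < 0) (u : ℂ)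
    (h : ∀ j : ℕ, qPow τ (2 * k * j) ≠ qPow τ 4) :
    correlationBase τ k u (u + (k + 2) * τ) ≠ 0 := by
  have hk2 := re_two_mul_neg hk
  refine mul_ne_zero (Complex.exp_ne_zero _) (div_ne_zero ?_ ?_)
  · refine qPochhammer_ne_zero (norm_exp_lt_one hk2) fun j h1 => h j ?_
    rw [pointRatio_residuePoint, ← Complex.exp_nat_mul, ← Complex.exp_add] at h1
    rw [qPow, qPow]
    calc _ = Complex.exp (4 * τ) *
          Complex.exp ((k - 2 - (k + 2)) * τ + j * (2 * k * τ)) := by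
          rw [← Complex.exp_add]; congr 1; ring
      _ = _ := by rw [h1, mul_one]
  · refine qPochhammer_ne_zero (norm_exp_lt_one hk2) fun j => ?_
    rw [pointRatio_residuePoint, show (3 * k + 2 - (k + 2)) * τ = 2 * k * τ by ring, ← pow_succ']
    intro h
    have h2 := pow_lt_one₀ (norm_nonneg _) (norm_exp_lt_one hk2) (Nat.succ_ne_zero j)
    rw [← norm_pow, h, norm_one] at h2
    exact lt_irrefl _ h2

end Current

/-! ### The contour integral of the product of currents -/

section Main

variable {τ k : ℂ}

theorem productTerm_currents (τ k u ζ : ℂ) (v : FockSum) (d : Charge) (t : Mode →₀ ℕ)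
    (s : Charge × (Mode →₀ ℕ)) :
    productTerm (PhiMinus τ k ζ) (PhiPlus τ k u) v d t s =
      1 / (qPow τ 1 - qPow τ (-1)) ^ 2 *
        (productTerm (vertexOp τ k (phiMinus₁ τ k ζ)) (vertexOp τ k (phiPlus₁ τ k u)) v d t s -
          productTerm (vertexOp τ k (phiMinus₂ τ k ζ)) (vertexOp τ k (phiPlus₁ τ k u)) v d t s -
          productTerm (vertexOp τ k (phiMinus₁ τ k ζ)) (vertexOp τ k (phiPlus₂ τ k u)) v d t s +
          productTerm (vertexOp τ k (phiMinus₂ τ k ζ)) (vertexOp τ k (phiPlus₂ τ k u)) v d t s) :=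
  by
  simp only [productTerm, PhiMinus, PhiPlus, matrixElement_smul_left, matrixElement_sub_left]
  rw [← one_div_pow]
  ring

theorem lambda₁_eq (τ k u : ℂ) : lambda₁ τ k u =
    (1 / (qPow τ 1 - qPow τ (-1)) ^ 2 * rho τ k u *
      (Complex.exp τ * correlationFactor τ k u (u + (k + 2) * τ))) •
    vertexOp τ k (phiMinus₁ τ k (u + (k + 2) * τ) + phiPlus₁ τ k u) := by
  have h1 : u + (3 * k + 6) / 2 * τ = u + (k + 2) * τ + (k + 2) / 2 * τ := by ring
  have h2 : u + (3 * k + 4) / 2 * τ = u + (k + 2) * τ + k / 2 * τ := by ring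
  rw [lambda₁, h1, h2, phiMinus₁, phiPlus₁, correlationFactor, pointRatio_residuePoint,
    pointRatio_residuePoint, qPow, qPow, qPow, qPow, one_mul]
  congr 1
  · rw [show (-(k + 2) - (k + 2)) = -(2 * k) - 4 by ring,
      show (-k - (k + 2)) = -(2 * k) - 2 by ring]
    ring
  · rw [← add_assoc, ← add_assoc]

theorem lambda₂_eq (τ k u : ℂ) : lambda₂ τ k u =
    (-(1 / (qPow τ 1 - qPow τ (-1)) ^ 2) * rho τ k u * Complex.exp (-τ)) •
    vertexOp τ k (phiMinus₂ τ k (u + (k + 2) * τ) + phiPlus₁ τ k u) := by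
  have h1 : u + (k + 4) / 2 * τ = u + (k + 2) * τ - k / 2 * τ := by ring
  have h2 : u + (k + 2) / 2 * τ = u + (k + 2) * τ - (k + 2) / 2 * τ := by ring
  rw [lambda₂, h1, h2, phiMinus₂, phiPlus₁, ← add_assoc, ← add_assoc, qPow, qPow, neg_one_mul]

theorem lambda₃_eq (τ k u : ℂ) : lambda₃ τ k u =
    (-(1 / (qPow τ 1 - qPow τ (-1)) ^ 2) * rho τ k u * Complex.exp τ) •
    vertexOp τ k (phiMinus₁ τ k (u + (k + 2) * τ) + phiPlus₂ τ k u) := by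
  have h1 : u + (3 * k + 6) / 2 * τ = u + (k + 2) * τ + (k + 2) / 2 * τ := by ring
  have h2 : u + (3 * k + 4) / 2 * τ = u + (k + 2) * τ + k / 2 * τ := by ring
  rw [lambda₃, h1, h2, phiMinus₁, phiPlus₂, ← add_assoc, ← add_assoc, qPow, qPow, one_mul]

theorem isContourIntegral_currents (hq : τ.re < 0) (hk : (k * τ).re < 0) (u : ℂ) :
    IsContourIntegral (PhiMinus τ k) (PhiPlus τ k u) (u + (k + 2) * τ)
      (lambda₁ τ k u + lambda₂ τ k u + lambda₃ τ k u) := by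
  intro v d t
  obtain ⟨m₁₁, R₁₁, h₁₁⟩ := isCorrelationFunction₁₁ hq hk u
  obtain ⟨m₂₁, R₂₁, h₂₁⟩ := isCorrelationFunction₂₁ hq hk u
  obtain ⟨m₁₂, R₁₂, h₁₂⟩ := isCorrelationFunction₁₂ hq hk u
  obtain ⟨m₂₂, R₂₂, h₂₂⟩ := isCorrelationFunction₂₂ hq hk u
  have d₁₁ := differentiable_matrixElement_phiMinus₁ τ k (phiPlus₁ τ k u) v d t
  have d₂₁ := differentiable_matrixElement_phiMinus₂ τ k (phiPlus₁ τ k u) v d t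
  have d₁₂ := differentiable_matrixElement_phiMinus₁ τ k (phiPlus₂ τ k u) v d t
  have d₂₂ := differentiable_matrixElement_phiMinus₂ τ k (phiPlus₂ τ k u) v d t
  set e : ℂ := 1 / (qPow τ 1 - qPow τ (-1)) ^ 2 with he
  refine ⟨fun ζ => e * (correlation₁₁ τ k u ζ *
        matrixElement (vertexOp τ k (phiMinus₁ τ k ζ + phiPlus₁ τ k u)) v d t -
      correlation₂₁ τ k u ζ *
        matrixElement (vertexOp τ k (phiMinus₂ τ k ζ + phiPlus₁ τ k u)) v d t -
      correlation₁₂ τ k u ζ *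
        matrixElement (vertexOp τ k (phiMinus₁ τ k ζ + phiPlus₂ τ k u)) v d t +
      correlation₂₂ τ k u ζ *
        matrixElement (vertexOp τ k (phiMinus₂ τ k ζ + phiPlus₂ τ k u)) v d t),
    ⟨?_, max (max R₁₁ R₂₁) (max R₁₂ R₂₂), fun ζ hζ => ?_⟩, ?_⟩
  · exact (Meromorphic.const e).mul ((((m₁₁.mul d₁₁.meromorphic).sub
      (m₂₁.mul d₂₁.meromorphic)).sub (m₁₂.mul d₁₂.meromorphic)).add (m₂₂.mul d₂₂.meromorphic))
  · simp only [max_lt_iff] at hζ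
    obtain ⟨⟨r₁₁, r₂₁⟩, r₁₂, r₂₂⟩ := hζ
    have hs := ((((h₁₁ ζ r₁₁ v d t).sub (h₂₁ ζ r₂₁ v d t)).sub (h₁₂ ζ r₁₂ v d t)).add
      (h₂₂ ζ r₂₂ v d t)).mul_left e
    rw [funext (productTerm_currents τ k u ζ v d t)]
    exact hs
  · have aB := analyticAt_correlationBase hk u
    have aF := analyticAt_correlationFactor hq hk u
    set ζ₀ := u + (k + 2) * τ with hζ₀
    -- `G` collects the three products sharing the factor `(1 - w₀/w)⁻¹`; the fourth product is
    -- regular at `w₀`, plays the role of `H` and drops out.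
    have hG : AnalyticAt ℂ (fun ζ => e * correlationBase τ k u ζ *
        (Complex.exp τ * correlationFactor τ k u ζ *
          matrixElement (vertexOp τ k (phiMinus₁ τ k ζ + phiPlus₁ τ k u)) v d t -
        Complex.exp (-τ) *
          matrixElement (vertexOp τ k (phiMinus₂ τ k ζ + phiPlus₁ τ k u)) v d t -
        Complex.exp τ *
          matrixElement (vertexOp τ k (phiMinus₁ τ k ζ + phiPlus₂ τ k u)) v d t)) ζ₀ :=
      (analyticAt_const.mul aB).mul ((((analyticAt_const.mul aF).mul (d₁₁.analyticAt _)).sub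
        (analyticAt_const.mul (d₂₁.analyticAt _))).sub (analyticAt_const.mul (d₁₂.analyticAt _)))
    have hH : AnalyticAt ℂ (fun ζ => e * (correlation₂₂ τ k u ζ *
        matrixElement (vertexOp τ k (phiMinus₂ τ k ζ + phiPlus₂ τ k u)) v d t)) ζ₀ :=
      analyticAt_const.mul (((analyticAt_inv_one_sub_pointRatio u k ζ₀
        (pointRatio_residuePoint_ne_one hq u)).mul (analyticAt_const.mul aB)).mul
        (d₂₂.analyticAt _))
    filter_upwards [circleIntegral_log_eventually hG hH] with r hr
    rw [matrixElement_add_left, matrixElement_add_left, lambda₁_eq, lambda₂_eq, lambda₃_eq,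
      matrixElement_smul_left, matrixElement_smul_left, matrixElement_smul_left, rho_eq hk, ← hζ₀,
      ← he]
    refine Eq.trans ?_ (hr.trans ?_)
    · congr 1
      funext w
      simp only [correlation₁₁, correlation₂₁, correlation₁₂, pointRatio_eq_exp_sub, ← hζ₀]
      ring
    · ring

/-! ### Linear independence -/

theorem coeff_single_multiExp {σ : Type*} (c : σ → ℂ) (i : σ) (n : ℕ) :
    MvPowerSeries.coeff (Finsupp.single i n) (multiExp c) = (n.factorial : ℂ)⁻¹ * c i ^ n := by
  rw [coeff_multiExp, Finsupp.prod_single_index (by simp), smul_eq_mul]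

theorem matrixElement_vacuum (τ k : ℂ) {Φ : LinForm} (h : Φ.2 = 0) (t : Mode →₀ ℕ) :
    matrixElement (vertexOp τ k Φ) (Finsupp.single 0 1) 0 t =
      MvPowerSeries.coeff t (multiExp Φ.creationCoeff) := by
  rw [matrixElement_vertexOp_single, if_pos (by simp [h]), map_one, MvPolynomial.coe_one, mul_one,
    expCreation_eq_multiExp]
  simp [LinForm.zeroMode, zeroEigenvalue]

/-- Normally ordered exponentials of charge zero whose coefficients of one creation operator are
pairwise distinct are linearly independent. -/
theorem linearIndependent_vertexOp (τ k : ℂ) {ι : Type*} [Fintype ι] (Φ : ι → LinForm) (i : Mode)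
    (h : ∀ j, (Φ j).2 = 0) (hinj : Function.Injective fun j => (Φ j).creationCoeff i) :
    LinearIndependent ℂ fun j => vertexOp τ k (Φ j) := by
  classical
  rw [Fintype.linearIndependent_iff]
  intro c hc
  -- The component of the image of the vacuum along the `n`-th power of the creation operator `i` is
  -- `(creation coefficient)^n / n!`.
  have hpow : ∀ n : ℕ, ∑ j, c j * (Φ j).creationCoeff i ^ n = 0 := by
    intro n
    have h1 := congrArg (fun A => matrixElement A (Finsupp.single 0 1) 0 (Finsupp.single i n)) hc
    have h2 : ∀ s : Finset ι, matrixElement (∑ j ∈ s, c j • vertexOp τ k (Φ j))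
        (Finsupp.single 0 1) 0 (Finsupp.single i n) = ∑ j ∈ s, c j *
          ((n.factorial : ℂ)⁻¹ * (Φ j).creationCoeff i ^ n) := by
      intro s
      induction s using Finset.induction_on with
      | empty => simp [matrixElement]
      | insert j s hj ih =>
        rw [Finset.sum_insert hj, Finset.sum_insert hj, matrixElement_add_left, ih,
          matrixElement_smul_left, matrixElement_vacuum τ k (h j), coeff_single_multiExp]
    simp only [h2] at h1
    have h3 : matrixElement (0 : FockOp) (Finsupp.single 0 1) 0 (Finsupp.single i n) = 0 := by
      simp [matrixElement]
    rw [h3] at h1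
    have h4 : ((n.factorial : ℕ) : ℂ) ≠ 0 := by exact_mod_cast n.factorial_ne_zero
    have h5 : (n.factorial : ℂ)⁻¹ * ∑ j, c j * (Φ j).creationCoeff i ^ n = 0 := by
      rw [← h1, Finset.mul_sum]
      exact Finset.sum_congr rfl fun j _ => by ring
    exact (mul_eq_zero.mp h5).resolve_left (inv_ne_zero h4)
  have hpoly : ∀ P : Polynomial ℂ, ∑ j, c j * P.eval ((Φ j).creationCoeff i) = 0 := by
    intro P
    induction P using Polynomial.induction_on' with
    | add P Q hP hQ => simp only [Polynomial.eval_add, mul_add, Finset.sum_add_distrib, hP, hQ,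
        add_zero]
    | monomial n a =>
      simp only [Polynomial.eval_monomial]
      calc _ = a * ∑ j, c j * (Φ j).creationCoeff i ^ n := by
            rw [Finset.mul_sum]; exact Finset.sum_congr rfl fun j _ => by ring
        _ = 0 := by rw [hpow, mul_zero]
  intro j
  -- The Lagrange polynomial vanishing at all other nodes isolates `c j`.
  have h6 := hpoly (∏ l ∈ Finset.univ.erase j,
    (Polynomial.X - Polynomial.C ((Φ l).creationCoeff i)))
  rw [Finset.sum_eq_single j] at h6
  · refine (mul_eq_zero.mp h6).resolve_right ?_
    rw [Polynomial.eval_prod]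
    refine Finset.prod_ne_zero_iff.mpr fun l hl => ?_
    rw [Polynomial.eval_sub, Polynomial.eval_X, Polynomial.eval_C, sub_ne_zero]
    exact fun heq => Finset.ne_of_mem_erase hl (hinj heq).symm
  · intro l _ hl
    rw [Polynomial.eval_prod, Finset.prod_eq_zero (Finset.mem_erase.mpr ⟨hl, Finset.mem_univ l⟩)]
    · rw [mul_zero]
    · simp
  · exact fun hj => absurd (Finset.mem_univ j) hj

theorem wMinus_creationCoeff_ne_zero (hq : τ.re < 0) (s : ℂ) :
    (wMinus τ s).creationCoeff (.beta, 1) ≠ 0 := by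
  rw [wMinus_creationCoeff, minusModes_neg]
  have h1 : qNum τ ((1 : ℕ+) : ℕ) ≠ 0 := qNum_ne_zero hq (by simpa using hq)
  have h2 : qNum τ (2 * ((1 : ℕ+) : ℕ)) ≠ 0 :=
    qNum_ne_zero hq (re_mul_pnat_neg (two_mul_re_neg hq) 1)
  exact mul_ne_zero (mul_ne_zero (qPow_sub_ne_zero hq) (Complex.exp_ne_zero _)) (div_ne_zero h1 h2)

theorem wMinus_creationCoeff_add (s a : ℂ) : (wMinus τ (s + a)).creationCoeff (.beta, 1) =
    Complex.exp a * (wMinus τ s).creationCoeff (.beta, 1) := by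
  rw [wMinus_creationCoeff, minusModes_neg, wMinus_creationCoeff, minusModes_neg, mul_add,
    Complex.exp_add]
  simp only [PNat.one_coe, Nat.cast_one, one_mul]
  ring

theorem rho_ne_zero (hk : (k * τ).re < 0) (u : ℂ)
    (h : ∀ j : ℕ, qPow τ (2 * k * j) ≠ qPow τ 4) : rho τ k u ≠ 0 := by
  rw [rho_eq hk]
  exact mul_ne_zero (mul_ne_zero Complex.two_pi_I_ne_zero (Complex.exp_ne_zero _))
    (correlationBase_ne_zero hk u h)

/-- The mode `β_{-1}` separates the operators: it is absent from the first, enters the second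
through `W₋⁻¹` with coefficient `-q² b` and the third through `W₋` with coefficient `b ≠ 0`. These
differ because `|q| < 1` excludes `q² = -1`. The scalars are nonzero since `ρ(z) ≠ 0`. -/
theorem linearIndependent_lambda (hq : τ.re < 0) (hk : (k * τ).re < 0) (u : ℂ)
    (h : ∀ j : ℕ, qPow τ (2 * k * j) ≠ qPow τ 4) :
    LinearIndependent ℂ ![lambda₁ τ k u, lambda₂ τ k u, lambda₃ τ k u] := by
  have hr := rho_ne_zero hk u h
  have hD : 1 / (qPow τ 1 - qPow τ (-1)) ^ 2 ≠ 0 :=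
    one_div_ne_zero (pow_ne_zero _ (qPow_sub_ne_zero hq))
  set ζ₀ := u + (k + 2) * τ with hζ₀
  set Φ : Fin 3 → LinForm := ![phiMinus₁ τ k ζ₀ + phiPlus₁ τ k u,
    phiMinus₂ τ k ζ₀ + phiPlus₁ τ k u, phiMinus₁ τ k ζ₀ + phiPlus₂ τ k u] with hΦ
  have h2 : ∀ j, (Φ j).2 = 0 := by
    intro j
    funext b
    fin_cases j <;> cases b <;> simp [hΦ, phiMinus₁, phiMinus₂, phiPlus₁, phiPlus₂, yMinus, yPlus,
      zPlus, zMinus, wPlus, wMinus, LinForm.ofBoson]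
  set b := (wMinus τ (u + k / 2 * τ)).creationCoeff (.beta, 1) with hb
  have hb0 : b ≠ 0 := wMinus_creationCoeff_ne_zero hq _
  have c₁ : (Φ 0).creationCoeff (.beta, 1) = 0 := by
    simp [hΦ, LinForm.creationCoeff, phiMinus₁, phiPlus₁, yMinus, yPlus, zPlus, wPlus,
      LinForm.ofBoson, plusModes]
  have c₂ : (Φ 1).creationCoeff (.beta, 1) = -(Complex.exp (2 * τ) * b) := by
    -- The argument of `W₋⁻¹` at `w₀` is `q^{-k/2} w₀ = q² · q^{k/2} z`, which is the source of the
    -- factor `q²`.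
    rw [hb, ← wMinus_creationCoeff_add, show u + k / 2 * τ + 2 * τ = ζ₀ - k / 2 * τ by
      rw [hζ₀]; ring]
    simp [hΦ, LinForm.creationCoeff, phiMinus₂, phiPlus₁, yMinus, yPlus, zPlus, wPlus, zMinus,
      wMinus, LinForm.ofBoson, plusModes]
  have c₃ : (Φ 2).creationCoeff (.beta, 1) = b := by
    simp [hΦ, hb, LinForm.creationCoeff, phiMinus₁, phiPlus₂, yMinus, yPlus, zPlus, wPlus, zMinus,
      wMinus, LinForm.ofBoson, plusModes]
  have hne : Complex.exp (2 * τ) + 1 ≠ 0 := by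
    have h3 := exp_sq_add_one_ne_zero (τ := τ) 1 hq
    rw [← exp_two_mul_sq] at h3
    simpa using h3
  have hinj : Function.Injective fun j => (Φ j).creationCoeff (.beta, 1) := by
    have h01 : (0 : ℂ) ≠ -(Complex.exp (2 * τ) * b) :=
      (neg_ne_zero.mpr (mul_ne_zero (Complex.exp_ne_zero _) hb0)).symm
    have h12 : -(Complex.exp (2 * τ) * b) ≠ b := fun h3 =>
      mul_ne_zero hne hb0 (by linear_combination -h3)
    have hval : (fun j => (Φ j).creationCoeff (.beta, 1)) =
        ![0, -(Complex.exp (2 * τ) * b), b] := by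
      funext j
      fin_cases j
      · exact c₁
      · exact c₂
      · exact c₃
    rw [hval]
    intro i j hij
    fin_cases i <;> fin_cases j <;> first
      | rfl
      | exact absurd hij h01
      | exact absurd hij h01.symm
      | exact absurd hij h12
      | exact absurd hij h12.symm
      | exact absurd hij hb0
      | exact absurd hij hb0.symm
  have hli := linearIndependent_vertexOp τ k Φ (.beta, 1) h2 hinj
  set w : Fin 3 → ℂˣ := ![
    Units.mk0 _ (mul_ne_zero (mul_ne_zero hD hr)
      (mul_ne_zero (Complex.exp_ne_zero τ) (correlationFactor_ne_zero hq hk u))),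
    Units.mk0 _ (mul_ne_zero (mul_ne_zero (neg_ne_zero.mpr hD) hr) (Complex.exp_ne_zero (-τ))),
    Units.mk0 _ (mul_ne_zero (mul_ne_zero (neg_ne_zero.mpr hD) hr) (Complex.exp_ne_zero τ))] with hw
  have := hli.units_smul w
  convert this using 1
  funext j
  rw [lambda₁_eq, lambda₂_eq, lambda₃_eq]
  fin_cases j <;> rfl

/-! ### Exact orders of the four correlation functions -/

theorem meromorphicOrderAt_correlation₁₁ (hq : τ.re < 0) (hk : (k * τ).re < 0) (u : ℂ)
    (h : ∀ j : ℕ, qPow τ (2 * k * j) ≠ qPow τ 4) :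
    meromorphicOrderAt (correlation₁₁ τ k u) (u + (k + 2) * τ) = ((-1 : ℤ) : WithTop ℤ) := by
  unfold correlation₁₁
  simp only [pointRatio_eq_exp_sub]
  exact meromorphicOrderAt_inv_one_sub_exp_mul
    ((analyticAt_const.mul (analyticAt_correlationFactor hq hk u)).mul
      (analyticAt_correlationBase hk u))
    (mul_ne_zero (mul_ne_zero (Complex.exp_ne_zero _) (correlationFactor_ne_zero hq hk u))
      (correlationBase_ne_zero hk u h))

theorem meromorphicOrderAt_correlation₂₁ (hk : (k * τ).re < 0) (u : ℂ)
    (h : ∀ j : ℕ, qPow τ (2 * k * j) ≠ qPow τ 4) :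
    meromorphicOrderAt (correlation₂₁ τ k u) (u + (k + 2) * τ) = ((-1 : ℤ) : WithTop ℤ) := by
  unfold correlation₂₁
  simp only [pointRatio_eq_exp_sub]
  exact meromorphicOrderAt_inv_one_sub_exp_mul
    (analyticAt_const.mul (analyticAt_correlationBase hk u))
    (mul_ne_zero (Complex.exp_ne_zero _) (correlationBase_ne_zero hk u h))

theorem meromorphicOrderAt_correlation₁₂ (hk : (k * τ).re < 0) (u : ℂ)
    (h : ∀ j : ℕ, qPow τ (2 * k * j) ≠ qPow τ 4) :
    meromorphicOrderAt (correlation₁₂ τ k u) (u + (k + 2) * τ) = ((-1 : ℤ) : WithTop ℤ) := by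
  unfold correlation₁₂
  simp only [pointRatio_eq_exp_sub]
  exact meromorphicOrderAt_inv_one_sub_exp_mul
    (analyticAt_const.mul (analyticAt_correlationBase hk u))
    (mul_ne_zero (Complex.exp_ne_zero _) (correlationBase_ne_zero hk u h))

theorem meromorphicOrderAt_correlation₂₂ (hq : τ.re < 0) (hk : (k * τ).re < 0) (u : ℂ)
    (h : ∀ j : ℕ, qPow τ (2 * k * j) ≠ qPow τ 4) :
    meromorphicOrderAt (correlation₂₂ τ k u) (u + (k + 2) * τ) = ((0 : ℤ) : WithTop ℤ) := by
  have ha : AnalyticAt ℂ (correlation₂₂ τ k u) (u + (k + 2) * τ) :=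
    (analyticAt_inv_one_sub_pointRatio u k _ (pointRatio_residuePoint_ne_one hq u)).mul
      (analyticAt_const.mul (analyticAt_correlationBase hk u))
  -- The remaining denominator is `1 - q^{-2}` at this point, so the function is finite and nonzero
  -- there.
  have h0 : correlation₂₂ τ k u (u + (k + 2) * τ) ≠ 0 :=
    mul_ne_zero (inv_ne_zero (sub_ne_zero.mpr (pointRatio_residuePoint_ne_one hq u).symm))
      (mul_ne_zero (Complex.exp_ne_zero _) (correlationBase_ne_zero hk u h))
  rw [ha.meromorphicOrderAt_eq, ha.analyticOrderAt_eq_zero.mpr h0]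
  rfl

end Main

end

theorem mainTheorem2 (τ k u : ℂ) (hq : τ.re < 0) (hk : (k * τ).re < 0) :
    IsContourIntegral (PhiMinus τ k) (PhiPlus τ k u) (u + (k + 2) * τ)
      (lambda₁ τ k u + lambda₂ τ k u + lambda₃ τ k u) ∧
    ((∀ j : ℕ, qPow τ (2 * k * j) ≠ qPow τ 4) →
      LinearIndependent ℂ ![lambda₁ τ k u, lambda₂ τ k u, lambda₃ τ k u] ∧
      (∃ C, IsCorrelationFunction τ k (phiMinus₁ τ k) (phiPlus₁ τ k u) C ∧
        meromorphicOrderAt C (u + (k + 2) * τ) = ((-1 : ℤ) : WithTop ℤ)) ∧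
      (∃ C, IsCorrelationFunction τ k (phiMinus₂ τ k) (phiPlus₁ τ k u) C ∧
        meromorphicOrderAt C (u + (k + 2) * τ) = ((-1 : ℤ) : WithTop ℤ)) ∧
      (∃ C, IsCorrelationFunction τ k (phiMinus₁ τ k) (phiPlus₂ τ k u) C ∧
        meromorphicOrderAt C (u + (k + 2) * τ) = ((-1 : ℤ) : WithTop ℤ)) ∧
      (∃ C, IsCorrelationFunction τ k (phiMinus₂ τ k) (phiPlus₂ τ k u) C ∧
        meromorphicOrderAt C (u + (k + 2) * τ) = ((0 : ℤ) : WithTop ℤ))) := by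
  exact ⟨isContourIntegral_currents hq hk u, fun h => ⟨linearIndependent_lambda hq hk u h,
    ⟨_, isCorrelationFunction₁₁ hq hk u, meromorphicOrderAt_correlation₁₁ hq hk u h⟩,
    ⟨_, isCorrelationFunction₂₁ hq hk u, meromorphicOrderAt_correlation₂₁ hk u h⟩,
    ⟨_, isCorrelationFunction₁₂ hq hk u, meromorphicOrderAt_correlation₁₂ hk u h⟩,
    ⟨_, isCorrelationFunction₂₂ hq hk u, meromorphicOrderAt_correlation₂₂ hq hk u h⟩⟩⟩
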